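/- Let the base stations of a cellular downlink form a homogeneous Poisson point process of intensity $\lambda>0$ in $\mathbb R^2$. All base stations transmit with power $P>0$, the path loss exponent is $\alpha>2$, the noise power is $\sigma^2\ge 0$, and the fading coefficients $g_z$ between the base stations $z$ and a user at a fixed location are i.i.d. exponential with rate $\mu>0$ (mean $1/\mu$), independent of the locations of the base stations. The user is served by its closest base station $y$, at distance $r$, and on the sub-band shared by all cells its signal to interference plus noise ratio is $$\mathrm{SINR}=\frac{P g_y r^{-\alpha}}{\sigma^2+P I_r},\qquad I_r=\sum_{z\ne y} g_z R_z^{-\alpha},$$ where $R_z$ is the distance of $z$ to the user. Given a reuse threshold $T_{FR}>0$, the user is an interior user of Strict FFR if $\mathrm{SINR}>T_{FR}$; it then stays on the common sub-band, so that its coverage probability at a threshold $T$ is $\bar F_{\mathrm{FFR},i}(T)=\mathbb P(\mathrm{SINR}>T\mid \mathrm{SINR}>T_{FR})$. Put $$\rho(T,\alpha)=T^{2/\alpha}\int_{T^{-2/\alpha}}^\infty\frac{du}{1+u^{\alpha/2}},\qquad p_c(T,\lambda,\alpha,\Delta)=\pi\lambda\int_0^\infty e^{-\pi\lambda v\left(1+\frac1\Delta\rho(T,\alpha)\right)-\mu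 T\frac{\sigma^2}{P}v^{\alpha/2}}\,dv .$$ Then $\mathbb P(\mathrm{SINR}>T_{FR})>0$, $p_c(T_{FR},\lambda,\alpha,1)>0$, and for every $T$ $$\bar F_{\mathrm{FFR},i}(T)=\frac{p_c(\max\{T,T_{FR}\},\lambda,\alpha,1)}{p_c(T_{FR},\lambda,\alpha,1)} .$$ -/

import Mathlib

open MeasureTheory ProbabilityTheory

noncomputable section

namespace StrictFFR

/-- The plane with its Euclidean metric and Lebesgue measure. -/
abbrev Plane : Type := EuclideanSpace ℝ (Fin 2)

variable {Ω : Type*}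

/-- The number of points of the configuration `X · ω` that lie in `B`. -/
def pointCount (X : ℕ → Ω → Plane) (B : Set Plane) (ω : Ω) : ℕ∞ :=
  {n : ℕ | X n ω ∈ B}.encard

/-- The random points `X 0, X 1, …` form a (listed) homogeneous Poisson point process of
intensity `lam` in the plane: the number of points in a Borel set `B` of finite area is Poisson
distributed with mean `lam * area B`, and the numbers of points in finitely many pairwise disjoint
such sets are independent. The order in which the points are listed is arbitrary. -/
structure IsHomogeneousPPP [MeasurableSpace Ω] (prob : Measure Ω) (X : ℕ → Ω → Plane)
    (lam : ℝ) : Prop where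
  measurable : ∀ n, Measurable (X n)
  count_law : ∀ B : Set Plane, MeasurableSet B → volume B ≠ ⊤ → ∀ k : ℕ,
    prob {ω | pointCount X B ω = k} =
      ENNReal.ofReal (Real.exp (-(lam * (volume B).toReal)) *
        (lam * (volume B).toReal) ^ k / (k.factorial : ℝ))
  count_indep : ∀ (m : ℕ) (B : Fin m → Set Plane), (∀ i, MeasurableSet (B i)) →
    (∀ i, volume (B i) ≠ ⊤) → Pairwise (fun i j => Disjoint (B i) (B j)) →
    iIndepFun (fun i => pointCount X (B i)) prob

/-- The downlink model: base stations at the points of a homogeneous Poisson point process of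
intensity `lam`; the fading coefficients `g n` of the base stations on the common sub-band are
i.i.d. exponential with rate `mu` and independent of the base station locations. -/
structure IsDownlink [MeasurableSpace Ω] (prob : Measure Ω) (X : ℕ → Ω → Plane)
    (g : ℕ → Ω → ℝ) (lam mu : ℝ) : Prop where
  ppp : IsHomogeneousPPP prob X lam
  fading_measurable : ∀ n, Measurable (g n)
  fading_law : ∀ n, prob.map (g n) = expMeasure mu
  fading_iIndep : iIndepFun g prob
  fading_indep_locations : IndepFun (fun ω n => g n ω) (fun ω n => X n ω) prob

/-- The serving base station of a user at `u`: the (index of the) closest base station. It is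
almost surely unique; ties are resolved in favour of the smallest index. -/
def serving (X : ℕ → Ω → Plane) (u : Plane) (ω : Ω) : ℕ :=
  sInf {n : ℕ | ∀ m, dist (X n ω) u ≤ dist (X m ω) u}

/-- The interference `∑ g_z R_z ^ (-α)` at `u` on the sub-band shared by all cells, where `z`
runs over all base stations other than the serving one. The sum is taken in `[0, ∞]`. -/
def interference (X : ℕ → Ω → Plane) (g : ℕ → Ω → ℝ) (α : ℝ) (u : Plane) (ω : Ω) : ENNReal :=
  ∑' z : {n : ℕ // n ≠ serving X u ω},
    ENNReal.ofReal (g z.1 ω) * edist (X z.1 ω) u ^ (-α)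

/-- The SINR `P g_y r ^ (-α) / (σ² + P I_r)` at `u` on the sub-band shared by all cells, where
`r` is the distance to the serving base station and `g_y` its fading coefficient; a number
in `[0, ∞]`. -/
def sinr (X : ℕ → Ω → Plane) (g : ℕ → Ω → ℝ) (P σ α : ℝ) (u : Plane) (ω : Ω) : ENNReal :=
  (ENNReal.ofReal P * ENNReal.ofReal (g (serving X u ω) ω) *
      edist (X (serving X u ω) ω) u ^ (-α)) /
    (ENNReal.ofReal (σ ^ 2) + ENNReal.ofReal P * interference X g α u ω)

/-- The event that the SINR on the common sub-band exceeds `t`. -/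
def sinrAbove (X : ℕ → Ω → Plane) (g : ℕ → Ω → ℝ) (P σ α : ℝ) (u : Plane) (t : ℝ) : Set Ω :=
  {ω | ENNReal.ofReal t < sinr X g P σ α u ω}

/-- The coverage probability at threshold `T` of an interior user of Strict FFR: a user whose SINR
on the common sub-band exceeds the reuse threshold `TFR` stays on that sub-band, so this is the
conditional probability of `SINR > T` given `SINR > TFR`. -/
def interiorCoverage [MeasurableSpace Ω] (prob : Measure Ω) (X : ℕ → Ω → Plane) (g : ℕ → Ω → ℝ)
    (P σ α : ℝ) (u : Plane) (TFR T : ℝ) : ℝ :=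
  (ProbabilityTheory.cond prob (sinrAbove X g P σ α u TFR) (sinrAbove X g P σ α u T)).toReal

/-- `ρ(T, α) = T^{2/α} ∫_{T^{-2/α}}^∞ 1 / (1 + u^{α/2}) du`. -/
def rho (T α : ℝ) : ℝ :=
  T ^ (2 / α) * ∫ u in Set.Ioi (T ^ (-(2 / α))), 1 / (1 + u ^ (α / 2))

/-- `p_c(T, λ, α, Δ)
  = π λ ∫_0^∞ exp (-π λ v (1 + ρ(T, α) / Δ) - μ T (σ² / P) v^{α/2}) dv`
(the parameters `mu`, `σ`, `P` are left implicit in the traditional notation). -/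
def pc (mu σ P T lam α Δ : ℝ) : ℝ :=
  Real.pi * lam * ∫ v in Set.Ioi (0 : ℝ),
    Real.exp (-Real.pi * lam * v * (1 + 1 / Δ * rho T α) - mu * T * (σ ^ 2 / P) * v ^ (α / 2))

end StrictFFR

end

/-! Since `SINR > T` and `SINR > T_FR` together mean `SINR > max T T_FR`, the conditional
probability is a ratio of two unconditional coverage probabilities. The point is thus `P(SINR > t) =
p_c(t, λ, α, 1)` for `t > 0`, proved in `IsDownlink.prob_sinrAbove`; positivity comes from that of
the integrand.

Squared distances to the user form a Poisson process with intensity `πλ dv` on the half-line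
(`isPoisson_dist_sq`); this is the variable `v` of `p_c`. Freeze the locations, as independence of
the fading allows (`lintegral_prob_sinr`). The exponential tail of the serving fading then turns
coverage into a noise factor times one factor `1 / (1 + t (v_y / v_z)^{α/2})` per interferer
(`prob_interference_lt_fading`). Encoding "a closer point exists" as an infinite cost rewrites this
as a sum over all candidate serving points in which only the nearest contributes
(`prob_sinr_const`).

The expectation of such a sum is a Mecke-type integral (`lintegral_tsum_expNeg`), derived here from
the count axioms alone. If the cost depends on the candidate only through a cell, and vanishes on
that cell, then the count in the cell is independent of everything the cost sees. Refining dyadic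
cells gives the true cost in the limit. In the resulting exponent, points closer than `v` contribute
`πλv` and farther ones `πλv ρ(t, α)`. The same formula with zero noise and threshold shows that the
nearest point is almost surely unique. -/

noncomputable section

namespace StrictFFR

open scoped ENNReal
open Filter Topology

/-! ### The exponential `e^{-y}` on `[0, ∞]`. -/

section

/-- `expNeg y = e^{-y}` as a map `[0, ∞] → [0, 1]`, with `expNeg ∞ = 0`. -/
def expNeg (y : ℝ≥0∞) : ℝ≥0∞ := (EReal.exp y)⁻¹

lemma expNeg_continuous : Continuous expNeg :=
  continuous_inv.comp (ENNReal.continuous_exp.comp continuous_coe_ennreal_ereal)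

@[fun_prop]
lemma expNeg_measurable : Measurable expNeg := expNeg_continuous.measurable

lemma expNeg_antitone : Antitone expNeg := fun _ _ h =>
  ENNReal.inv_le_inv.2 (EReal.exp_monotone (EReal.coe_ennreal_le_coe_ennreal_iff.2 h))

@[simp] lemma expNeg_zero : expNeg 0 = 1 := by simp [expNeg]

@[simp] lemma expNeg_top : expNeg ⊤ = 0 := by simp [expNeg]

lemma expNeg_le_one (y : ℝ≥0∞) : expNeg y ≤ 1 := by
  simpa using expNeg_antitone (zero_le (a := y))

lemma expNeg_ofReal {x : ℝ} (hx : 0 ≤ x) :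
    expNeg (ENNReal.ofReal x) = ENNReal.ofReal (Real.exp (-x)) := by
  rw [expNeg, EReal.coe_ennreal_ofReal, max_eq_left hx, EReal.exp_coe, Real.exp_neg,
    ENNReal.ofReal_inv_of_pos (Real.exp_pos _)]

lemma expNeg_add (x y : ℝ≥0∞) : expNeg (x + y) = expNeg x * expNeg y := by
  simp only [expNeg, EReal.coe_ennreal_add, EReal.exp_add]
  refine ENNReal.mul_inv (Or.inl ?_) (Or.inr ?_)
  · simp
  · simp

lemma expNeg_sum {ι : Type*} (s : Finset ι) (f : ι → ℝ≥0∞) :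
    expNeg (∑ i ∈ s, f i) = ∏ i ∈ s, expNeg (f i) := by
  classical
  induction s using Finset.induction_on with
  | empty => simp
  | insert a s ha ih => rw [Finset.sum_insert ha, Finset.prod_insert ha, expNeg_add, ih]

lemma expNeg_tendsto {f : ℕ → ℝ≥0∞} {y : ℝ≥0∞} (h : Filter.Tendsto f Filter.atTop (nhds y)) :
    Filter.Tendsto (fun k => expNeg (f k)) Filter.atTop (nhds (expNeg y)) :=
  (expNeg_continuous.tendsto y).comp h

lemma one_sub_expNeg_ofReal {x : ℝ} (hx : 0 ≤ x) :
    1 - expNeg (ENNReal.ofReal x) = ENNReal.ofReal (1 - Real.exp (-x)) := by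
  rw [expNeg_ofReal hx, ENNReal.ofReal_sub _ (Real.exp_pos _).le, ENNReal.ofReal_one]

/-- Real logarithm form: `e^{-log x} = 1/x`. -/
lemma expNeg_ofReal_log {x : ℝ} (hx : 1 ≤ x) :
    expNeg (ENNReal.ofReal (Real.log x)) = ENNReal.ofReal x⁻¹ := by
  rw [expNeg_ofReal (Real.log_nonneg hx), Real.exp_neg, Real.exp_log (by linarith)]

end

/-! ### Poisson processes: law, mean and Laplace transform of counts. -/

section

variable {Ω : Type*}

/-- The number of indices `n` with `V n ω ∈ B`. -/
def listCount {S : Type*} (V : ℕ → Ω → S) (B : Set S) (ω : Ω) : ℕ∞ :=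
  {n : ℕ | V n ω ∈ B}.encard

/-- A listed Poisson point process with intensity measure `ν`. -/
structure IsPoisson [MeasurableSpace Ω] {S : Type*} [MeasurableSpace S] (prob : Measure Ω)
    (V : ℕ → Ω → S) (ν : Measure S) : Prop where
  measurable : ∀ n, Measurable (V n)
  count_law : ∀ B : Set S, MeasurableSet B → ν B ≠ ⊤ → ∀ k : ℕ,
    prob {ω | listCount V B ω = k} =
      ENNReal.ofReal (Real.exp (-(ν B).toReal) * (ν B).toReal ^ k / (k.factorial : ℝ))
  count_indep : ∀ (m : ℕ) (B : Fin m → Set S), (∀ i, MeasurableSet (B i)) →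
    (∀ i, ν (B i) ≠ ⊤) → Pairwise (fun i j => Disjoint (B i) (B j)) →
    iIndepFun (fun i => listCount V (B i)) prob

lemma listCount_toENNReal {S : Type*} (V : ℕ → Ω → S) (B : Set S) (ω : Ω) :
    (listCount V B ω : ℝ≥0∞) = ∑' n, B.indicator (fun _ => 1) (V n ω) := by
  have h : ∀ n, B.indicator (fun _ => (1 : ℝ≥0∞)) (V n ω) =
      {n : ℕ | V n ω ∈ B}.indicator (fun _ => 1) n := fun n => rfl
  simp_rw [h]
  rw [← tsum_subtype, ENNReal.tsum_set_one]
  rfl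

variable [MeasurableSpace Ω]

lemma listCount_measurable {S : Type*} [MeasurableSpace S] {V : ℕ → Ω → S}
    (hV : ∀ n, Measurable (V n)) {B : Set S} (hB : MeasurableSet B) :
    Measurable (listCount V B) := by
  have h1 : Measurable fun ω => (listCount V B ω : ℝ≥0∞) := by
    simp_rw [listCount_toENNReal]
    exact Measurable.tsum fun n => (measurable_const.indicator hB).comp (hV n)
  rw [ENat.measurable_iff]
  intro n
  have : listCount V B ⁻¹' {(n : ℕ∞)} = {ω | (listCount V B ω : ℝ≥0∞) = (n : ℝ≥0∞)} := by
    ext ω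
    simp only [Set.mem_preimage, Set.mem_singleton_iff, Set.mem_ofPred_eq]
    rw [← ENat.toENNReal_coe, ENat.toENNReal_inj]
  rw [this]
  exact h1 (measurableSet_singleton _)

/-- The Poisson generating function: `q = 1` gives the total mass, `q = e^{-r}` the Laplace
transform. -/
lemma hasSum_poisson_weight (m q : ℝ) :
    HasSum (fun k : ℕ => q ^ k * (Real.exp (-m) * m ^ k / (k.factorial : ℝ)))
      (Real.exp (-(m * (1 - q)))) := by
  have h := (NormedSpace.expSeries_div_hasSum_exp (q * m)).mul_left (Real.exp (-m))
  rw [← Real.exp_eq_exp_ℝ, ← Real.exp_add] at h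
  rw [show -(m * (1 - q)) = -m + q * m by ring]
  have hk : ∀ k : ℕ, q ^ k * (Real.exp (-m) * m ^ k / (k.factorial : ℝ)) =
      Real.exp (-m) * ((q * m) ^ k / (k.factorial : ℝ)) := fun k => by rw [mul_pow]; ring
  simp_rw [hk]
  exact h

section

variable {S : Type*} [MeasurableSpace S] {prob : Measure Ω} [IsProbabilityMeasure prob]
  {V : ℕ → Ω → S} {ν : Measure S} (h : IsPoisson prob V ν) {B : Set S}
  (hB : MeasurableSet B) (hfin : ν B ≠ ⊤)
include h hB hfin

/-- The probabilities of the finite values already sum to 1, leaving no mass at `⊤`. -/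
lemma IsPoisson.ae_listCount_ne_top : ∀ᵐ ω ∂prob, listCount V B ω ≠ ⊤ := by
  have hm := listCount_measurable h.measurable hB
  have h1 : prob (⋃ k : ℕ, {ω | listCount V B ω = k}) = 1 := by
    rw [measure_iUnion]
    · simp_rw [h.count_law B hB hfin]
      have := hasSum_poisson_weight (ν B).toReal 1
      simp only [one_pow, one_mul, sub_self, mul_zero, neg_zero, Real.exp_zero] at this
      rw [← ENNReal.ofReal_tsum_of_nonneg (fun k => by positivity) this.summable, this.tsum_eq,
        ENNReal.ofReal_one]
    · intro i j hij
      refine Set.disjoint_left.2 fun ω hi hj => hij ?_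
      simp only [Set.mem_ofPred_eq] at hi hj
      rw [hi] at hj
      exact_mod_cast hj
    · exact fun k => hm (measurableSet_singleton _)
  have hms : MeasurableSet (⋃ k : ℕ, {ω | listCount V B ω = k}) :=
    MeasurableSet.iUnion fun k => hm (measurableSet_singleton (k : ℕ∞))
  have h2 := (prob_compl_eq_zero_iff hms).2 h1
  refine measure_mono_null (fun ω hω => ?_) h2
  simp only [Set.mem_compl_iff, Set.mem_ofPred_eq, not_not] at hω
  simp [hω]

lemma IsPoisson.lintegral_listCount (φ : ℕ∞ → ℝ≥0∞) :
    ∫⁻ ω, φ (listCount V B ω) ∂prob = ∑' k : ℕ, φ k *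
      ENNReal.ofReal (Real.exp (-(ν B).toReal) * (ν B).toReal ^ k / (k.factorial : ℝ)) := by
  have hm := listCount_measurable h.measurable hB
  have h1 : ∀ᵐ ω ∂prob, φ (listCount V B ω) =
      ∑' k : ℕ, {ω | listCount V B ω = k}.indicator (fun _ => φ k) ω := by
    filter_upwards [h.ae_listCount_ne_top hB hfin] with ω hω
    obtain ⟨n, hn⟩ := ENat.ne_top_iff_exists.1 hω
    rw [tsum_eq_single n]
    · simp [hn]
    · intro k hk
      apply Set.indicator_of_notMem
      simp only [Set.mem_ofPred_eq, ← hn]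
      exact_mod_cast hk.symm
  have hms : ∀ k : ℕ, MeasurableSet {ω | listCount V B ω = k} :=
    fun k => hm (measurableSet_singleton (k : ℕ∞))
  rw [lintegral_congr_ae h1, lintegral_tsum fun k =>
    (measurable_const.indicator (hms k)).aemeasurable]
  refine tsum_congr fun k => ?_
  rw [← h.count_law B hB hfin, lintegral_indicator_const (hms k)]

lemma IsPoisson.lintegral_count_eq : ∫⁻ ω, (listCount V B ω : ℝ≥0∞) ∂prob = ν B := by
  rw [h.lintegral_listCount hB hfin (fun x => x)]
  have h1 := hasSum_poisson_weight (ν B).toReal 1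
  simp only [one_pow, one_mul, sub_self, mul_zero, neg_zero, Real.exp_zero] at h1
  -- The term `k = 0` vanishes; shifting the index cancels the factor `k + 1` against the factorial
  -- and releases one factor `ν B`.
  rw [tsum_eq_zero_add' ENNReal.summable]
  simp only [Nat.cast_zero, ENat.toENNReal_zero, zero_mul, zero_add]
  have h2 : ∀ k : ℕ, (((k + 1 : ℕ) : ℕ∞) : ℝ≥0∞) * ENNReal.ofReal
      (Real.exp (-(ν B).toReal) * (ν B).toReal ^ (k + 1) / ((k + 1).factorial : ℝ)) =
      ν B * ENNReal.ofReal (Real.exp (-(ν B).toReal) * (ν B).toReal ^ k / (k.factorial : ℝ)) := by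
    intro k
    rw [ENat.toENNReal_coe, ← ENNReal.ofReal_natCast, ← ENNReal.ofReal_mul (by positivity)]
    conv_rhs => arg 1; rw [← ENNReal.ofReal_toReal hfin]
    rw [← ENNReal.ofReal_mul ENNReal.toReal_nonneg]
    congr 1
    rw [Nat.factorial_succ]
    push_cast
    field_simp
    ring
  simp_rw [h2]
  rw [ENNReal.tsum_mul_left, ← ENNReal.ofReal_tsum_of_nonneg (fun k => by positivity) h1.summable,
    h1.tsum_eq, ENNReal.ofReal_one, mul_one]

lemma IsPoisson.lintegral_expNeg_count {y : ℝ≥0∞} (hy : y ≠ ⊤) :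
    ∫⁻ ω, expNeg (y * (listCount V B ω : ℝ≥0∞)) ∂prob = expNeg (ν B * (1 - expNeg y)) := by
  rw [h.lintegral_listCount hB hfin (fun x => expNeg (y * (x : ℝ≥0∞)))]
  obtain ⟨r, hr, rfl⟩ : ∃ r : ℝ, 0 ≤ r ∧ y = ENNReal.ofReal r :=
    ⟨y.toReal, ENNReal.toReal_nonneg, (ENNReal.ofReal_toReal hy).symm⟩
  have h1 := hasSum_poisson_weight (ν B).toReal (Real.exp (-r))
  have hq : 0 ≤ 1 - Real.exp (-r) := by
    have : Real.exp (-r) ≤ 1 := Real.exp_le_one_iff.2 (by linarith)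
    linarith
  rw [one_sub_expNeg_ofReal hr]
  conv_rhs => arg 1; arg 1; rw [← ENNReal.ofReal_toReal hfin]
  rw [← ENNReal.ofReal_mul ENNReal.toReal_nonneg, expNeg_ofReal (by positivity), ← h1.tsum_eq,
    ENNReal.ofReal_tsum_of_nonneg (fun k => by positivity) h1.summable]
  refine tsum_congr fun k => ?_
  rw [ENat.toENNReal_coe, ← ENNReal.ofReal_natCast, ← ENNReal.ofReal_mul hr,
    expNeg_ofReal (by positivity), ← ENNReal.ofReal_mul (by positivity), ← Real.exp_nat_mul]
  congr 3
  ring_nf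

end

end

/-! ### Laplace functionals and a Mecke-type formula. -/

section

section
variable {Ω : Type*} [MeasurableSpace Ω]
variable {S : Type*} [MeasurableSpace S] {prob : Measure Ω} [IsProbabilityMeasure prob]
  {V : ℕ → Ω → S} {ν : Measure S}

omit [IsProbabilityMeasure prob] in
lemma IsPoisson.count_indep_fintype (h : IsPoisson prob V ν) {ι : Type*} [Fintype ι]
    (B : ι → Set S) (hB : ∀ i, MeasurableSet (B i)) (hfin : ∀ i, ν (B i) ≠ ⊤)
    (hd : Pairwise (fun i j => Disjoint (B i) (B j))) :
    iIndepFun (fun i => listCount V (B i)) prob := by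
  let e := Fintype.equivFin ι
  have h1 := h.count_indep (Fintype.card ι) (fun i => B (e.symm i)) (fun i => hB _)
    (fun i => hfin _) (fun i j hij => hd (fun h => hij (e.symm.injective h)))
  have h2 := h1.precomp e.injective
  simpa using h2

-- The points are grouped by level sets. The value 0 is dropped because its level set may have
-- infinite measure, where the count law says nothing.
omit [MeasurableSpace Ω] in
lemma tsum_simpleFunc_eq (s : SimpleFunc S ℝ≥0∞) (ω : Ω) :
    ∑' n, s (V n ω) = ∑ y ∈ s.range.erase 0, y * (listCount V (s ⁻¹' {y}) ω : ℝ≥0∞) := by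
  classical
  have h1 : ∀ x, s x = ∑ y ∈ s.range.erase 0, y * (s ⁻¹' {y}).indicator (fun _ => 1) x := by
    intro x
    by_cases hx : s x = 0
    · rw [hx, Finset.sum_eq_zero]
      intro y hy
      rw [Set.indicator_of_notMem, mul_zero]
      simp only [Set.mem_preimage, Set.mem_singleton_iff, hx]
      exact (Finset.ne_of_mem_erase hy).symm
    · rw [Finset.sum_eq_single (s x)]
      · simp
      · intro y _ hyx
        rw [Set.indicator_of_notMem, mul_zero]
        simpa using hyx.symm
      · intro hn
        exact absurd (Finset.mem_erase.2 ⟨hx, s.mem_range_self x⟩) hn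
  simp_rw [listCount_toENNReal, ← ENNReal.tsum_mul_left]
  rw [← Summable.tsum_finsetSum (fun _ _ => ENNReal.summable)]
  exact tsum_congr fun n => h1 _

/-- As `s` vanishes on `A`, the set `A` and the nonzero level sets of `s` are disjoint, so their
counts are independent and the expectation factors into a mean and Laplace transforms. -/
lemma IsPoisson.lintegral_count_mul_expNeg_simpleFunc (h : IsPoisson prob V ν) {A : Set S}
    (hA : MeasurableSet A) (hAfin : ν A ≠ ⊤) (s : SimpleFunc S ℝ≥0∞) (hs : ∀ x, s x ≠ ⊤)
    (hsA : ∀ x ∈ A, s x = 0) (hsfin : ∀ y ≠ 0, ν (s ⁻¹' {y}) ≠ ⊤) :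
    ∫⁻ ω, (listCount V A ω : ℝ≥0∞) * expNeg (∑' n, s (V n ω)) ∂prob =
      ν A * expNeg (∫⁻ x, (1 - expNeg (s x)) ∂ν) := by
  classical
  let R := s.range.erase 0
  -- `none` indexes `A`, and `some y` the level set of `y`.
  let B : Option R → Set S := fun o => o.elim A fun y => s ⁻¹' {(y : ℝ≥0∞)}
  have hR : ∀ y : R, (y : ℝ≥0∞) ≠ 0 := fun y => Finset.ne_of_mem_erase y.2
  have hB : ∀ i, MeasurableSet (B i) := by
    rintro (_ | y)
    · exact hA
    · exact s.measurableSet_fiber _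
  have hfin : ∀ i, ν (B i) ≠ ⊤ := by
    rintro (_ | y)
    · exact hAfin
    · exact hsfin _ (hR y)
  have hd : Pairwise (fun i j => Disjoint (B i) (B j)) := by
    rintro (_ | y) (_ | z) hyz
    · exact absurd rfl hyz
    · refine Set.disjoint_left.2 fun x hx hx' => hR z ?_
      rw [← hsA x hx]; exact (Set.mem_singleton_iff.1 hx').symm
    · refine Set.disjoint_left.2 fun x hx' hx => hR y ?_
      rw [← hsA x hx]; exact (Set.mem_singleton_iff.1 hx').symm
    · refine Set.disjoint_left.2 fun x hx hx' => hyz ?_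
      have h1 : s x = y := hx
      have h2 : s x = z := hx'
      rw [Subtype.ext (h1.symm.trans h2)]
  let φ : Option R → ℕ∞ → ℝ≥0∞ := fun o x => o.elim (x : ℝ≥0∞) fun y => expNeg (y * (x : ℝ≥0∞))
  have hind := (h.count_indep_fintype B hB hfin hd).comp φ (fun _ => .of_discrete)
  have hprod := lintegral_prod_eq_prod_lintegral_of_indepFun Finset.univ _ hind
    (fun i => (Measurable.of_discrete (f := φ i)).comp (listCount_measurable h.measurable (hB i)))
  simp only [Fintype.prod_option, Function.comp_apply] at hprod
  have hL : ∀ ω, (listCount V A ω : ℝ≥0∞) * expNeg (∑' n, s (V n ω)) =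
      φ none (listCount V (B none) ω) * ∏ y : R, φ (some y) (listCount V (B (some y)) ω) := by
    intro ω
    rw [tsum_simpleFunc_eq, expNeg_sum, ← Finset.prod_coe_sort]
    rfl
  simp_rw [hL]
  rw [hprod]
  have h1 : ∫⁻ ω, φ none (listCount V (B none) ω) ∂prob = ν A := h.lintegral_count_eq hA hAfin
  have h2 : ∀ y : R, ∫⁻ ω, φ (some y) (listCount V (B (some y)) ω) ∂prob =
      expNeg (ν (s ⁻¹' {(y : ℝ≥0∞)}) * (1 - expNeg y)) := by
    intro y
    refine h.lintegral_expNeg_count (s.measurableSet_fiber _) (hsfin _ (hR y)) ?_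
    obtain ⟨x, hx⟩ := SimpleFunc.mem_range.1 (Finset.mem_of_mem_erase y.2)
    rw [← hx]
    exact hs x
  rw [h1]
  simp_rw [h2]
  rw [Finset.prod_coe_sort R (fun y => expNeg (ν (s ⁻¹' {y}) * (1 - expNeg y))), ← expNeg_sum]
  congr 2
  have h3 : ∫⁻ x, (1 - expNeg (s x)) ∂ν = (s.map fun y => 1 - expNeg y).lintegral ν := by
    rw [← SimpleFunc.lintegral_eq_lintegral]
    rfl
  rw [h3, SimpleFunc.map_lintegral, ← Finset.sum_erase s.range (a := 0)]
  · exact Finset.sum_congr rfl fun y _ => mul_comm _ _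
  · simp

lemma IsPoisson.lintegral_count_mul_expNeg [SigmaFinite ν] (h : IsPoisson prob V ν) {A : Set S}
    (hA : MeasurableSet A) (hAfin : ν A ≠ ⊤) {l : S → ℝ≥0∞} (hl : Measurable l)
    (hlA : ∀ x ∈ A, l x = 0) :
    ∫⁻ ω, (listCount V A ω : ℝ≥0∞) * expNeg (∑' n, l (V n ω)) ∂prob =
      ν A * expNeg (∫⁻ x, (1 - expNeg (l x)) ∂ν) := by
  classical
  -- Restricting to spanning sets gives the nonzero levels finite measure while keeping monotone
  -- convergence to `l`.
  let s : ℕ → SimpleFunc S ℝ≥0∞ := fun k =>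
    (SimpleFunc.eapprox l k).restrict (spanningSets ν k)
  have hsx : ∀ k x, s k x = (spanningSets ν k).indicator (SimpleFunc.eapprox l k) x := fun k x =>
    SimpleFunc.restrict_apply _ (measurableSet_spanningSets ν k) x
  have hle : ∀ k x, SimpleFunc.eapprox l k x ≤ l x := fun k x => by
    rw [← SimpleFunc.iSup_eapprox_apply hl x]
    exact le_iSup (fun n => (SimpleFunc.eapprox l n) x) k
  have hmono : Monotone fun k x => s k x := by
    intro i j hij x
    simp only [hsx]
    refine (Set.indicator_le_indicator_of_subset (monotone_spanningSets ν hij)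
      (fun _ => zero_le) x).trans ?_
    exact Set.indicator_le_indicator (SimpleFunc.monotone_eapprox l hij x)
  have hlim : ∀ x, Tendsto (fun k => s k x) atTop (𝓝 (l x)) := by
    intro x
    refine (SimpleFunc.tendsto_eapprox hl x).congr' ?_
    filter_upwards [eventually_ge_atTop (spanningSetsIndex ν x)] with k hk
    rw [hsx, Set.indicator_of_mem]
    exact mem_spanningSets_of_index_le ν x hk
  have hsimple : ∀ k, ∫⁻ ω, (listCount V A ω : ℝ≥0∞) * expNeg (∑' n, s k (V n ω)) ∂prob =
      ν A * expNeg (∫⁻ x, (1 - expNeg (s k x)) ∂ν) := by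
    intro k
    refine h.lintegral_count_mul_expNeg_simpleFunc hA hAfin (s k) (fun x => ?_) (fun x hx => ?_)
      (fun y hy => ?_)
    · rw [hsx]
      by_cases hx : x ∈ spanningSets ν k
      · rw [Set.indicator_of_mem hx]; exact (SimpleFunc.eapprox_lt_top l k x).ne
      · rw [Set.indicator_of_notMem hx]; simp
    · rw [hsx]
      refine le_antisymm ((Set.indicator_le_self _ _ x).trans ((hle k x).trans (hlA x hx).le))
        zero_le
    · refine ((measure_mono fun x hx => ?_).trans_lt (measure_spanningSets_lt_top ν k)).ne
      by_contra hx'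
      have h1 : s k x = y := hx
      rw [hsx, Set.indicator_of_notMem hx'] at h1
      exact hy h1.symm
  have hsum : ∀ ω, Tendsto (fun k => ∑' n, s k (V n ω)) atTop (𝓝 (∑' n, l (V n ω))) := by
    intro ω
    -- Sums over the points become integrals for counting measure, so that monotone convergence
    -- applies.
    simp_rw [← lintegral_count]
    exact lintegral_tendsto_of_tendsto_of_monotone (fun k => Measurable.of_discrete.aemeasurable)
      (ae_of_all _ fun n i j hij => hmono hij _) (ae_of_all _ fun n => hlim _)
  have hN := listCount_measurable h.measurable hA
  have hN' : Measurable fun ω => (listCount V A ω : ℝ≥0∞) :=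
    (Measurable.of_discrete (f := fun x : ℕ∞ => (x : ℝ≥0∞))).comp hN
  have hleft : Tendsto (fun k => ∫⁻ ω, (listCount V A ω : ℝ≥0∞) *
      expNeg (∑' n, s k (V n ω)) ∂prob) atTop
      (𝓝 (∫⁻ ω, (listCount V A ω : ℝ≥0∞) * expNeg (∑' n, l (V n ω)) ∂prob)) := by
    refine lintegral_tendsto_of_tendsto_of_antitone (fun k => ?_) ?_ ?_ ?_
    · exact (hN'.mul (expNeg_measurable.comp
        (Measurable.tsum fun n => (s k).measurable.comp (h.measurable n)))).aemeasurable
    · exact ae_of_all _ fun ω i j hij => by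
        dsimp only
        gcongr
        exact expNeg_antitone (ENNReal.tsum_le_tsum fun n => hmono hij _)
    · refine ((lintegral_mono fun ω => ?_).trans_lt
        ((h.lintegral_count_eq hA hAfin).trans_lt hAfin.lt_top)).ne
      exact mul_le_of_le_one_right' (expNeg_le_one _)
    · filter_upwards [h.ae_listCount_ne_top hA hAfin] with ω hω
      exact ENNReal.Tendsto.const_mul (expNeg_tendsto (hsum ω)) (Or.inr (by simpa using hω))
  have hright : Tendsto (fun k => ν A * expNeg (∫⁻ x, (1 - expNeg (s k x)) ∂ν)) atTop
      (𝓝 (ν A * expNeg (∫⁻ x, (1 - expNeg (l x)) ∂ν))) := by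
    refine ENNReal.Tendsto.const_mul (expNeg_tendsto ?_) (Or.inr hAfin)
    refine lintegral_tendsto_of_tendsto_of_monotone (fun k => ?_) ?_ ?_
    · exact (measurable_const.sub (expNeg_measurable.comp (s k).measurable)).aemeasurable
    · exact ae_of_all _ fun x i j hij => tsub_le_tsub_left (expNeg_antitone (hmono hij x)) _
    · exact ae_of_all _ fun x => ENNReal.Tendsto.sub tendsto_const_nhds (expNeg_tendsto (hlim x))
        (Or.inl ENNReal.one_ne_top)
  simp_rw [hsimple] at hleft
  exact tendsto_nhds_unique hleft hright

omit [MeasurableSpace Ω] [MeasurableSpace S] in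
lemma tsum_comp_cell (cell : S → ℕ) (G : ℕ → ℝ≥0∞) (ω : Ω) :
    ∑' n, G (cell (V n ω)) = ∑' j, G j * (listCount V (cell ⁻¹' {j}) ω : ℝ≥0∞) := by
  simp_rw [listCount_toENNReal, ← ENNReal.tsum_mul_left]
  rw [ENNReal.tsum_comm]
  refine tsum_congr fun n => ?_
  rw [tsum_eq_single (cell (V n ω))]
  · simp
  · intro j hj
    rw [Set.indicator_of_notMem, mul_zero]
    simpa using hj.symm

lemma lintegral_comp_cell {cell : S → ℕ} (hcell : Measurable cell) (G : ℕ → ℝ≥0∞) :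
    ∫⁻ x, G (cell x) ∂ν = ∑' j, G j * ν (cell ⁻¹' {j}) := by
  rw [← lintegral_map (f := G) Measurable.of_discrete hcell, lintegral_countable']
  exact tsum_congr fun j => by rw [Measure.map_apply hcell (measurableSet_singleton j)]

/-- Summing over cells, `hl0` says that `l j` vanishes on cell `j`, which is what the product
formula requires. It also makes the self-interaction term harmless. -/
lemma IsPoisson.lintegral_tsum_expNeg_cell [SigmaFinite ν] (h : IsPoisson prob V ν)
    {cell : S → ℕ} (hcell : Measurable cell) (hfin : ∀ j, ν (cell ⁻¹' {j}) ≠ ⊤)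
    (θ : ℕ → ℝ≥0∞) {l : ℕ → S → ℝ≥0∞} (hl : ∀ j, Measurable (l j))
    (hl0 : ∀ x, l (cell x) x = 0) :
    ∫⁻ ω, ∑' n, expNeg (θ (cell (V n ω)) + ∑' m, l (cell (V n ω)) (V m ω)) ∂prob =
      ∫⁻ x, expNeg (θ (cell x) + ∫⁻ z, (1 - expNeg (l (cell x) z)) ∂ν) ∂ν := by
  rw [lintegral_comp_cell hcell
    (fun j => expNeg (θ j + ∫⁻ z, (1 - expNeg (l j z)) ∂ν))]
  have h1 : ∀ ω, ∑' n, expNeg (θ (cell (V n ω)) + ∑' m, l (cell (V n ω)) (V m ω)) =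
      ∑' j, expNeg (θ j) *
        ((listCount V (cell ⁻¹' {j}) ω : ℝ≥0∞) * expNeg (∑' m, l j (V m ω))) := by
    intro ω
    rw [tsum_comp_cell cell (fun j => expNeg (θ j + ∑' m, l j (V m ω))) ω]
    refine tsum_congr fun j => ?_
    rw [expNeg_add]; ring
  simp_rw [h1]
  have hA : ∀ j, MeasurableSet (cell ⁻¹' {j}) := fun j => hcell (measurableSet_singleton j)
  have hm : ∀ j, Measurable fun ω =>
      (listCount V (cell ⁻¹' {j}) ω : ℝ≥0∞) * expNeg (∑' m, l j (V m ω)) := fun j =>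
    ((Measurable.of_discrete (f := fun x : ℕ∞ => (x : ℝ≥0∞))).comp
      (listCount_measurable h.measurable (hA j))).mul (expNeg_measurable.comp
        (Measurable.tsum fun n => (hl j).comp (h.measurable n)))
  rw [lintegral_tsum fun j => ((hm j).const_mul _).aemeasurable]
  refine tsum_congr fun j => ?_
  rw [lintegral_const_mul _ (hm j), h.lintegral_count_mul_expNeg (hA j) (hfin j) (hl j)
    (fun x hx => by rw [← Set.mem_singleton_iff.1 hx, hl0]), expNeg_add]
  ring

/-- A Mecke-type formula for interactions that are increasing limits of interactions depending on
the typical point only through its cell in a countable partition. -/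
lemma IsPoisson.lintegral_tsum_expNeg [SigmaFinite ν] (h : IsPoisson prob V ν)
    {cell : ℕ → S → ℕ} (hcell : ∀ k, Measurable (cell k))
    (hfin : ∀ k j, ν (cell k ⁻¹' {j}) ≠ ⊤)
    {θ : ℕ → ℕ → ℝ≥0∞} {l : ℕ → ℕ → S → ℝ≥0∞} (hl : ∀ k j, Measurable (l k j))
    (hl0 : ∀ k x, l k (cell k x) x = 0)
    (hθmono : ∀ x, Monotone fun k => θ k (cell k x))
    (hlmono : ∀ x z, Monotone fun k => l k (cell k x) z)
    (hint : ∫⁻ x, expNeg (θ 0 (cell 0 x) + ∫⁻ z, (1 - expNeg (l 0 (cell 0 x) z)) ∂ν) ∂ν ≠ ⊤) :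
    ∫⁻ ω, ∑' n, expNeg ((⨆ k, θ k (cell k (V n ω))) +
        ∑' m, ⨆ k, l k (cell k (V n ω)) (V m ω)) ∂prob =
      ∫⁻ x, expNeg ((⨆ k, θ k (cell k x)) +
        ∫⁻ z, (1 - expNeg (⨆ k, l k (cell k x) z)) ∂ν) ∂ν := by
  have hk := fun k => h.lintegral_tsum_expNeg_cell (hcell k) (hfin k) (θ k) (hl k) (hl0 k)
  have hlm : ∀ k x, Measurable (l k (cell k x)) := fun k x => hl k _
  have hl2 : ∀ k, Measurable fun p : S × S => l k (cell k p.1) p.2 := fun k =>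
    measurable_from_prod_countable_right (f := fun p : ℕ × S => l k p.1 p.2) (hl k) |>.comp
      (((hcell k).comp measurable_fst).prodMk measurable_snd)
  have hθm : ∀ k, Measurable fun x => θ k (cell k x) := fun k =>
    (Measurable.of_discrete (f := θ k)).comp (hcell k)
  have hθlim : ∀ x, Tendsto (fun k => θ k (cell k x)) atTop (𝓝 (⨆ k, θ k (cell k x))) :=
    fun x => tendsto_atTop_iSup (hθmono x)
  have hllim : ∀ x z, Tendsto (fun k => l k (cell k x) z) atTop
      (𝓝 (⨆ k, l k (cell k x) z)) := fun x z => tendsto_atTop_iSup (hlmono x z)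
  have hleft : Tendsto (fun k => ∫⁻ ω, ∑' n, expNeg (θ k (cell k (V n ω)) +
      ∑' m, l k (cell k (V n ω)) (V m ω)) ∂prob) atTop
      (𝓝 (∫⁻ ω, ∑' n, expNeg ((⨆ k, θ k (cell k (V n ω))) +
        ∑' m, ⨆ k, l k (cell k (V n ω)) (V m ω)) ∂prob)) := by
    have hmeas : ∀ k n, Measurable fun ω => expNeg (θ k (cell k (V n ω)) +
        ∑' m, l k (cell k (V n ω)) (V m ω)) := fun k n =>
      expNeg_measurable.comp (((hθm k).comp (h.measurable n)).add
        (Measurable.tsum fun m => (hl2 k).comp ((h.measurable n).prodMk (h.measurable m))))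
    have hanti : ∀ ω n, Antitone fun k => expNeg (θ k (cell k (V n ω)) +
        ∑' m, l k (cell k (V n ω)) (V m ω)) := fun ω n i j hij =>
      expNeg_antitone (add_le_add (hθmono _ hij) (ENNReal.tsum_le_tsum fun m => hlmono _ _ hij))
    have hfin0 : ∫⁻ ω, ∑' n, expNeg (θ 0 (cell 0 (V n ω)) +
        ∑' m, l 0 (cell 0 (V n ω)) (V m ω)) ∂prob ≠ ⊤ := by rw [hk 0]; exact hint
    refine lintegral_tendsto_of_tendsto_of_antitone
      (fun k => (Measurable.tsum fun n => hmeas k n).aemeasurable)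
      (ae_of_all _ fun ω i j hij => ENNReal.tsum_le_tsum fun n => hanti ω n hij) hfin0 ?_
    -- Decreasing convergence inside the sum over `n` needs a finite sum at level 0; it is almost
    -- surely finite because its expectation is.
    filter_upwards [ae_lt_top (Measurable.tsum fun n => hmeas 0 n) hfin0] with ω hω
    simp_rw [← lintegral_count (fun n => expNeg _)] at hω ⊢
    refine lintegral_tendsto_of_tendsto_of_antitone
      (fun k => Measurable.of_discrete.aemeasurable) (ae_of_all _ fun n => hanti ω n) hω.ne
      (ae_of_all _ fun n => expNeg_tendsto ((hθlim _).add ?_))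
    simp_rw [← lintegral_count]
    exact lintegral_tendsto_of_tendsto_of_monotone (fun k => Measurable.of_discrete.aemeasurable)
      (ae_of_all _ fun m => hlmono _ _) (ae_of_all _ fun m => hllim _ _)
  have hright : Tendsto (fun k => ∫⁻ x, expNeg (θ k (cell k x) +
      ∫⁻ z, (1 - expNeg (l k (cell k x) z)) ∂ν) ∂ν) atTop
      (𝓝 (∫⁻ x, expNeg ((⨆ k, θ k (cell k x)) +
        ∫⁻ z, (1 - expNeg (⨆ k, l k (cell k x) z)) ∂ν) ∂ν)) := by
    have hmono : ∀ x z, Monotone fun k => 1 - expNeg (l k (cell k x) z) := fun x z i j hij =>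
      tsub_le_tsub_left (expNeg_antitone (hlmono x z hij)) _
    refine lintegral_tendsto_of_tendsto_of_antitone (fun k => ?_)
      (ae_of_all _ fun x i j hij => expNeg_antitone (add_le_add (hθmono x hij)
        (lintegral_mono fun z => hmono x z hij))) hint
      (ae_of_all _ fun x => expNeg_tendsto ((hθlim x).add ?_))
    · exact (expNeg_measurable.comp ((hθm k).add (Measurable.lintegral_prod_right'
        (measurable_const.sub (expNeg_measurable.comp (hl2 k)))))).aemeasurable
    · exact lintegral_tendsto_of_tendsto_of_monotone
        (fun k => (measurable_const.sub (expNeg_measurable.comp (hlm k x))).aemeasurable)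
        (ae_of_all _ fun z => hmono x z)
        (ae_of_all _ fun z => ENNReal.Tendsto.sub tendsto_const_nhds
          (expNeg_tendsto (hllim x z)) (Or.inl ENNReal.one_ne_top))
  simp_rw [hk] at hleft
  exact tendsto_nhds_unique hleft hright

end

end

/-! ### The half-line process and dyadic approximation of the nearest-point cost. -/

section

/-- The measure `c dx` on the positive half-line. -/
def rayMeasure (c : ℝ) : Measure ℝ := c.toNNReal • volume.restrict (Set.Ioi 0)

instance (c : ℝ) : SigmaFinite (rayMeasure c) := by unfold rayMeasure; infer_instance

lemma rayMeasure_apply (c : ℝ) {B : Set ℝ} (hB : MeasurableSet B) :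
    rayMeasure c B = ENNReal.ofReal c * volume (B ∩ Set.Ioi 0) := by
  rw [rayMeasure, Measure.smul_apply, Measure.restrict_apply hB]; rfl

lemma lintegral_rayMeasure (c : ℝ) (f : ℝ → ℝ≥0∞) :
    ∫⁻ x, f x ∂(rayMeasure c) = ENNReal.ofReal c * ∫⁻ x in Set.Ioi 0, f x := by
  rw [rayMeasure, lintegral_smul_measure]; rfl

lemma ae_rayMeasure_pos (c : ℝ) : ∀ᵐ x ∂(rayMeasure c), 0 < x :=
  Measure.ae_smul_measure (ae_restrict_mem measurableSet_Ioi) _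

/-- The dyadic cell of order `k` containing `x`. -/
def dyadicCell (k : ℕ) (x : ℝ) : ℕ := ⌊x * 2 ^ k⌋₊

lemma dyadicCell_measurable (k : ℕ) : Measurable (dyadicCell k) :=
  Nat.measurable_floor.comp (measurable_id.mul_const _)

lemma dyadicCell_succ_div_two (k : ℕ) (x : ℝ) : dyadicCell (k + 1) x / 2 = dyadicCell k x := by
  have := Nat.floor_div_natCast (x * 2 ^ (k + 1)) 2
  rw [dyadicCell, dyadicCell, ← this, pow_succ]
  congr 1
  push_cast
  ring

lemma dyadicCell_div_mono (k : ℕ) (x : ℝ) :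
    (dyadicCell k x : ℝ) / 2 ^ k ≤ (dyadicCell (k + 1) x : ℝ) / 2 ^ (k + 1) := by
  rw [div_le_div_iff₀ (by positivity) (by positivity), pow_succ, ← dyadicCell_succ_div_two]
  have : ((dyadicCell (k + 1) x / 2 : ℕ) : ℝ) * 2 ≤ (dyadicCell (k + 1) x : ℝ) := by
    exact_mod_cast Nat.div_mul_le_self _ 2
  have h2 : (0 : ℝ) < 2 ^ k := by positivity
  nlinarith

lemma dyadicCell_tendsto {x : ℝ} (hx : 0 ≤ x) :
    Tendsto (fun k => (dyadicCell k x : ℝ) / 2 ^ k) atTop (𝓝 x) :=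
  (tendsto_nat_floor_mul_div_atTop hx).comp
    (tendsto_pow_atTop_atTop_of_one_lt (one_lt_two : (1 : ℝ) < 2))

lemma rayMeasure_dyadicCell_ne_top (c : ℝ) (k j : ℕ) :
    rayMeasure c (dyadicCell k ⁻¹' {j}) ≠ ⊤ := by
  rw [rayMeasure_apply c (dyadicCell_measurable k (measurableSet_singleton j))]
  refine ENNReal.mul_ne_top ENNReal.ofReal_ne_top ?_
  refine ((measure_mono (t := Set.Ioo 0 (j + 1 : ℝ)) ?_).trans_lt (by simp)).ne
  rintro x ⟨hx, hx0⟩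
  refine ⟨hx0, ?_⟩
  have h1 : x * 2 ^ k < j + 1 := by
    rw [← Set.mem_singleton_iff.1 hx]; exact Nat.lt_floor_add_one _
  have h2 : (1 : ℝ) ≤ 2 ^ k := one_le_pow₀ one_le_two
  have h3 : 0 < x := hx0
  nlinarith

/-- The interaction of a nearest point at `x` with another point at `z`: a closer point is
forbidden, a farther one contributes the factor `1 / (1 + t (x / z) ^ β)`. -/
def nearestCost (t β x z : ℝ) : ℝ≥0∞ :=
  if z < x then ⊤ else if z = x then 0 else ENNReal.ofReal (Real.log (1 + t * (x / z) ^ β))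

/-- The discretization of `nearestCost` for a nearest point in the dyadic cell `j`. -/
def dyadicCost (t β : ℝ) (k j : ℕ) (z : ℝ) : ℝ≥0∞ :=
  if dyadicCell k z < j then ⊤ else if dyadicCell k z = j then 0
  else ENNReal.ofReal (Real.log (1 + t * ((j : ℝ) / 2 ^ k / z) ^ β))

lemma dyadicCost_measurable (t β : ℝ) (k j : ℕ) : Measurable (dyadicCost t β k j) := by
  refine Measurable.ite (dyadicCell_measurable k (.of_discrete (s := {i | i < j})))
    measurable_const (Measurable.ite (dyadicCell_measurable k (measurableSet_singleton j))
    measurable_const ?_)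
  fun_prop

lemma dyadicCost_self (t β : ℝ) (k : ℕ) (x : ℝ) : dyadicCost t β k (dyadicCell k x) x = 0 := by
  simp [dyadicCost]

/-- Refinement preserves the order of distinct cells. Points sharing a cell have cost 0, which can
only grow, and the left endpoint of the cell of `x` increases with `k`. -/
lemma dyadicCost_mono {t β : ℝ} (ht : 0 ≤ t) (hβ : 0 ≤ β) (x z : ℝ) :
    Monotone fun k => dyadicCost t β k (dyadicCell k x) z := by
  refine monotone_nat_of_le_succ fun k => ?_
  have hx := dyadicCell_succ_div_two k x
  have hz := dyadicCell_succ_div_two k z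
  unfold dyadicCost
  by_cases h1 : dyadicCell k z < dyadicCell k x
  · have h2 : dyadicCell (k + 1) z < dyadicCell (k + 1) x := by omega
    rw [if_pos h1, if_pos h2]
  by_cases h3 : dyadicCell k z = dyadicCell k x
  · rw [if_neg h1, if_pos h3]; exact zero_le
  have h2 : ¬ dyadicCell (k + 1) z < dyadicCell (k + 1) x := by omega
  have h4 : dyadicCell (k + 1) z ≠ dyadicCell (k + 1) x := by omega
  rw [if_neg h1, if_neg h3, if_neg h2, if_neg h4]
  have hz0 : 0 < z := by
    by_contra hneg
    have : dyadicCell k z = 0 :=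
      Nat.floor_of_nonpos (mul_nonpos_of_nonpos_of_nonneg (not_lt.1 hneg) (by positivity))
    omega
  have hd := dyadicCell_div_mono k x
  gcongr

lemma iSup_dyadicCost {t β : ℝ} (ht : 0 ≤ t) (hβ : 0 < β) {x z : ℝ} (hx : 0 < x) (hz : 0 < z) :
    ⨆ k, dyadicCost t β k (dyadicCell k x) z = nearestCost t β x z := by
  refine tendsto_nhds_unique (tendsto_atTop_iSup (dyadicCost_mono ht hβ.le x z)) ?_
  have hxl := dyadicCell_tendsto hx.le
  have hzl := dyadicCell_tendsto hz.le
  have hlt : ∀ {k : ℕ} {a b : ℝ}, (dyadicCell k a : ℝ) / 2 ^ k < (dyadicCell k b : ℝ) / 2 ^ k →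
      dyadicCell k a < dyadicCell k b := fun {k a b} h => by
    exact_mod_cast (div_lt_div_iff_of_pos_right (by positivity : (0 : ℝ) < 2 ^ k)).1 h
  rcases lt_trichotomy z x with h | h | h
  · refine Tendsto.congr' (f₁ := fun _ => ⊤) ?_ (by simp [nearestCost, h])
    filter_upwards [hzl.eventually_lt hxl h] with k hk
    rw [dyadicCost, if_pos (hlt hk)]
  · subst h
    simp [nearestCost, dyadicCost]
  · refine Tendsto.congr' (f₁ := fun k =>
      ENNReal.ofReal (Real.log (1 + t * ((dyadicCell k x : ℝ) / 2 ^ k / z) ^ β))) ?_ ?_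
    · filter_upwards [hxl.eventually_lt hzl h] with k hk
      have h1 := hlt hk
      rw [dyadicCost, if_neg h1.not_gt, if_neg h1.ne']
    · rw [nearestCost, if_neg h.not_gt, if_neg h.ne']
      refine ENNReal.tendsto_ofReal (Tendsto.log ?_ ?_)
      · exact tendsto_const_nhds.add (((hxl.div_const z).rpow_const (Or.inr hβ.le)).const_mul t)
      · positivity

variable {Ω : Type*} [MeasurableSpace Ω] {prob : Measure Ω} [IsProbabilityMeasure prob]
  {V : ℕ → Ω → ℝ} {c : ℝ}

lemma IsPoisson.ae_notMem {S : Type*} [MeasurableSpace S] {V : ℕ → Ω → S} {ν : Measure S}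
    (h : IsPoisson prob V ν) {B : Set S} (hB : MeasurableSet B) (hν : ν B = 0) :
    ∀ᵐ ω ∂prob, ∀ n, V n ω ∉ B := by
  have h1 : ∫⁻ ω, (listCount V B ω : ℝ≥0∞) ∂prob = 0 := by
    rw [h.lintegral_count_eq hB (by simp [hν]), hν]
  have hm : Measurable fun ω => (listCount V B ω : ℝ≥0∞) :=
    (Measurable.of_discrete (f := fun x : ℕ∞ => (x : ℝ≥0∞))).comp
      (listCount_measurable h.measurable hB)
  rw [lintegral_eq_zero_iff hm] at h1
  filter_upwards [h1] with ω hω n hn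
  have h2 : listCount V B ω = 0 := by simpa using hω
  rw [listCount, Set.encard_eq_zero] at h2
  have : n ∈ {n : ℕ | V n ω ∈ B} := hn
  rw [h2] at this
  exact this

lemma IsPoisson.ae_pos (h : IsPoisson prob V (rayMeasure c)) : ∀ᵐ ω ∂prob, ∀ n, 0 < V n ω := by
  filter_upwards [h.ae_notMem (B := Set.Iic 0) measurableSet_Iic
    (by rw [rayMeasure_apply c measurableSet_Iic, Set.Iic_inter_Ioi]; simp)] with ω hω n
  simpa using hω n

/-- The cost is infinite on the cells below that of `x`, which fill `(0, ⌊x⌋)` at order 0. The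
resulting bound `e^{-c(x - 1)}` supplies the finiteness needed for decreasing limits. -/
lemma lintegral_one_sub_expNeg_ge (hc : 0 ≤ c) (t β x : ℝ) :
    ENNReal.ofReal (c * (x - 1)) ≤
      ∫⁻ z, (1 - expNeg (dyadicCost t β 0 (dyadicCell 0 x) z)) ∂(rayMeasure c) := by
  have h1 : ENNReal.ofReal (c * (x - 1)) ≤
      rayMeasure c (Set.Iio (dyadicCell 0 x : ℝ)) := by
    rw [rayMeasure_apply c measurableSet_Iio, Set.Iio_inter_Ioi, Real.volume_Ioo,
      ENNReal.ofReal_mul hc, sub_zero]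
    gcongr
    have := Nat.lt_floor_add_one (x * 2 ^ 0)
    rw [dyadicCell]
    simp only [pow_zero, mul_one] at this ⊢
    linarith
  refine h1.trans ?_
  rw [← lintegral_indicator_one measurableSet_Iio]
  refine lintegral_mono_ae ?_
  filter_upwards [ae_rayMeasure_pos c] with z hz
  by_cases hzx : z ∈ Set.Iio (dyadicCell 0 x : ℝ)
  · have h2 : dyadicCell 0 z < dyadicCell 0 x := by
      rw [dyadicCell, pow_zero, mul_one, Nat.floor_lt hz.le]
      exact hzx
    simp [dyadicCost, h2, Set.indicator_of_mem hzx]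
  · simp [Set.indicator_of_notMem hzx]

lemma IsPoisson.lintegral_tsum_nearest (hc : 0 < c) (h : IsPoisson prob V (rayMeasure c))
    {s t β : ℝ} (hs : 0 ≤ s) (ht : 0 ≤ t) (hβ : 0 < β) :
    ∫⁻ ω, ∑' n, expNeg (ENNReal.ofReal (s * V n ω ^ β) +
        ∑' m, nearestCost t β (V n ω) (V m ω)) ∂prob =
      ∫⁻ x, expNeg (ENNReal.ofReal (s * x ^ β) +
        ∫⁻ z, (1 - expNeg (nearestCost t β x z)) ∂(rayMeasure c)) ∂(rayMeasure c) := by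
  let θ : ℕ → ℕ → ℝ≥0∞ := fun k j => ENNReal.ofReal (s * ((j : ℝ) / 2 ^ k) ^ β)
  have hθmono : ∀ x, Monotone fun k => θ k (dyadicCell k x) := fun x =>
    monotone_nat_of_le_succ fun k => by
      have hd := dyadicCell_div_mono k x
      simp only [θ]
      gcongr
  have hθ : ∀ x, 0 < x → ⨆ k, θ k (dyadicCell k x) = ENNReal.ofReal (s * x ^ β) := fun x hx =>
    tendsto_nhds_unique (tendsto_atTop_iSup (hθmono x)) (ENNReal.tendsto_ofReal
      (((dyadicCell_tendsto hx.le).rpow_const (Or.inr hβ.le)).const_mul s))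
  have hint : ∫⁻ x, expNeg (θ 0 (dyadicCell 0 x) +
      ∫⁻ z, (1 - expNeg (dyadicCost t β 0 (dyadicCell 0 x) z)) ∂(rayMeasure c))
        ∂(rayMeasure c) ≠ ⊤ := by
    have hexp : IntegrableOn (fun x => Real.exp (-c * x) * Real.exp c) (Set.Ioi 0) :=
      (exp_neg_integrableOn_Ioi 0 hc).mul_const _
    have hfin : ∫⁻ x, ENNReal.ofReal (Real.exp (-c * x) * Real.exp c) ∂(rayMeasure c) ≠ ⊤ := by
      rw [lintegral_rayMeasure]
      exact ENNReal.mul_ne_top ENNReal.ofReal_ne_top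
        ((lintegral_ofReal_le_lintegral_enorm _).trans_lt hexp.2).ne
    refine ((lintegral_mono fun x => ?_).trans_lt hfin.lt_top).ne
    refine (expNeg_antitone (le_add_left (lintegral_one_sub_expNeg_ge hc.le t β x))).trans ?_
    rw [← Real.exp_add]
    -- For `x` below 1 the lower bound truncates to 0, but there the majorant is at least 1.
    rcases le_total 0 (c * (x - 1)) with hx | hx
    · rw [expNeg_ofReal hx]
      apply le_of_eq
      congr 2; ring
    · refine (expNeg_le_one _).trans ?_
      rw [← ENNReal.ofReal_one]
      refine ENNReal.ofReal_le_ofReal (Real.one_le_exp ?_)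
      linarith
  have key := h.lintegral_tsum_expNeg dyadicCell_measurable (rayMeasure_dyadicCell_ne_top c)
    (θ := θ) (l := dyadicCost t β) (dyadicCost_measurable t β) (dyadicCost_self t β)
    hθmono (dyadicCost_mono ht hβ.le) hint
  have hleft : ∀ᵐ ω ∂prob, ∑' n, expNeg ((⨆ k, θ k (dyadicCell k (V n ω))) +
        ∑' m, ⨆ k, dyadicCost t β k (dyadicCell k (V n ω)) (V m ω)) =
      ∑' n, expNeg (ENNReal.ofReal (s * V n ω ^ β) +
        ∑' m, nearestCost t β (V n ω) (V m ω)) := by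
    filter_upwards [h.ae_pos] with ω hω
    refine tsum_congr fun n => ?_
    rw [hθ _ (hω n)]
    congr 2
    exact tsum_congr fun m => iSup_dyadicCost ht hβ (hω n) (hω m)
  rw [← lintegral_congr_ae hleft, key]
  refine lintegral_congr_ae ?_
  filter_upwards [ae_rayMeasure_pos c] with x hx
  rw [hθ x hx]
  congr 2
  refine lintegral_congr_ae ?_
  filter_upwards [ae_rayMeasure_pos c] with z hz
  rw [iSup_dyadicCost ht hβ hx hz]

end

/-! ### Evaluation of the integrals; existence and uniqueness of the nearest point. -/

section

lemma integrableOn_one_div_one_add_rpow {β a : ℝ} (hβ : 1 < β) (ha : 0 < a) :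
    IntegrableOn (fun u : ℝ => 1 / (1 + u ^ β)) (Set.Ioi a) := by
  have h1 : IntegrableOn (fun u : ℝ => u ^ (-β)) (Set.Ioi a) :=
    integrableOn_Ioi_rpow_of_lt (by linarith) ha
  refine Integrable.mono' h1
    (Measurable.aestronglyMeasurable (by fun_prop)) ?_
  filter_upwards [ae_restrict_mem measurableSet_Ioi] with u hu
  have hu0 : 0 < u := ha.trans hu
  have h2 : 0 < u ^ β := Real.rpow_pos_of_pos hu0 β
  rw [Real.norm_of_nonneg (by positivity), Real.rpow_neg hu0.le, one_div]
  gcongr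
  linarith

lemma rho_nonneg {T : ℝ} (hT : 0 ≤ T) (α : ℝ) : 0 ≤ rho T α := by
  refine mul_nonneg (by positivity) (setIntegral_nonneg measurableSet_Ioi fun u hu => ?_)
  have : 0 ≤ u := (Real.rpow_nonneg hT _).trans (le_of_lt hu)
  positivity

/-- With `w = t (x / z)^{α/2}` one has `1 - 1/(1 + w) = 1/(1 + w⁻¹)`, and the scaling `z = x t^{2/α}
u` yields the integral in `ρ`. -/
lemma lintegral_one_sub_inv_eq_rho {t α x : ℝ} (ht : 0 ≤ t) (hα : 2 < α) (hx : 0 < x) :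
    ∫⁻ z in Set.Ioi x, ENNReal.ofReal (1 - (1 + t * (x / z) ^ (α / 2))⁻¹) =
      ENNReal.ofReal (x * rho t α) := by
  rcases ht.eq_or_lt with rfl | ht
  · have h0 : (2 / α) ≠ 0 := by positivity
    simp [rho, Real.zero_rpow h0]
  set b := x * t ^ (2 / α) with hb
  have hb0 : 0 < b := by positivity
  have ha : b⁻¹ * x = t ^ (-(2 / α)) := by
    rw [Real.rpow_neg ht.le, hb, mul_inv]
    field_simp
  have ha0 : 0 < b⁻¹ * x := by positivity
  have hg := integrableOn_one_div_one_add_rpow (β := α / 2) (by linarith) ha0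
  have hg' : IntegrableOn (fun z : ℝ => 1 / (1 + (b⁻¹ * z) ^ (α / 2))) (Set.Ioi x) :=
    (integrableOn_Ioi_comp_mul_left_iff (fun u : ℝ => 1 / (1 + u ^ (α / 2))) x
      (inv_pos.2 hb0)).2 hg
  have h1 : ∀ z ∈ Set.Ioi x, ENNReal.ofReal (1 - (1 + t * (x / z) ^ (α / 2))⁻¹) =
      ENNReal.ofReal (1 / (1 + (b⁻¹ * z) ^ (α / 2))) := by
    intro z hz
    have hz0 : 0 < z := hx.trans hz
    congr 1
    have h2 : (b⁻¹ * z) ^ (α / 2) = (t * (x / z) ^ (α / 2))⁻¹ := by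
      rw [Real.mul_rpow (by positivity) hz0.le, Real.inv_rpow hb0.le, hb,
        Real.mul_rpow hx.le (by positivity), ← Real.rpow_mul ht.le,
        Real.div_rpow hx.le hz0.le, show 2 / α * (α / 2) = 1 by field_simp, Real.rpow_one]
      field_simp
    rw [h2]
    have h3 : 0 < t * (x / z) ^ (α / 2) := by positivity
    field_simp
    ring
  rw [setLIntegral_congr_fun measurableSet_Ioi h1, ← ofReal_integral_eq_lintegral_ofReal hg']
  · rw [integral_comp_mul_left_Ioi (fun u : ℝ => 1 / (1 + u ^ (α / 2))) x (inv_pos.2 hb0), ha,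
      inv_inv, smul_eq_mul, rho, hb, mul_assoc]
  · filter_upwards [ae_restrict_mem measurableSet_Ioi] with z hz
    have hz0 : 0 < z := hx.trans hz
    simp only [Pi.zero_apply]
    positivity

lemma lintegral_one_sub_expNeg_nearestCost {c t α x : ℝ} (hc : 0 ≤ c) (ht : 0 ≤ t) (hα : 2 < α)
    (hx : 0 < x) :
    ∫⁻ z, (1 - expNeg (nearestCost t (α / 2) x z)) ∂(rayMeasure c) =
      ENNReal.ofReal (c * x * (1 + rho t α)) := by
  rw [lintegral_rayMeasure]
  have h1 : ∀ z ∈ Set.Ioi (0 : ℝ), z ≠ x → 1 - expNeg (nearestCost t (α / 2) x z) =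
      (Set.Iio x).indicator 1 z + (Set.Ioi x).indicator
        (fun z => ENNReal.ofReal (1 - (1 + t * (x / z) ^ (α / 2))⁻¹)) z := by
    intro z hz hzx
    have hz0 : (0 : ℝ) < z := hz
    rcases hzx.lt_or_gt with h | h
    · simp [nearestCost, h, h.le]
    · have h2 : 1 ≤ 1 + t * (x / z) ^ (α / 2) := le_add_of_nonneg_right (by positivity)
      rw [nearestCost, if_neg h.not_gt, if_neg h.ne', expNeg_ofReal_log h2,
        Set.indicator_of_notMem (by simp [h.le]), Set.indicator_of_mem (Set.mem_Ioi.2 h), zero_add,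
        ENNReal.ofReal_sub _ (by positivity), ENNReal.ofReal_one]
  have h2 : ∫⁻ z in Set.Ioi 0, (1 - expNeg (nearestCost t (α / 2) x z)) =
      ∫⁻ z in Set.Ioi 0, ((Set.Iio x).indicator 1 z + (Set.Ioi x).indicator
        (fun z => ENNReal.ofReal (1 - (1 + t * (x / z) ^ (α / 2))⁻¹)) z) := by
    refine lintegral_congr_ae ?_
    filter_upwards [ae_restrict_mem measurableSet_Ioi,
      ae_restrict_of_ae (Measure.ae_ne volume x)] with z hz hzx
    exact h1 z hz hzx
  rw [h2, lintegral_add_left (measurable_one.indicator measurableSet_Iio),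
    lintegral_indicator_one measurableSet_Iio, setLIntegral_indicator measurableSet_Ioi,
    Measure.restrict_apply measurableSet_Iio, Set.Iio_inter_Ioi, Real.volume_Ioo, sub_zero,
    Set.inter_eq_left.2 (Set.Ioi_subset_Ioi hx.le), lintegral_one_sub_inv_eq_rho ht hα hx,
    ← ENNReal.ofReal_add hx.le (mul_nonneg hx.le (rho_nonneg ht α)), ← ENNReal.ofReal_mul hc]
  congr 1
  ring

variable {Ω : Type*} [MeasurableSpace Ω] {prob : Measure Ω} [IsProbabilityMeasure prob]
  {V : ℕ → Ω → ℝ} {c : ℝ}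

lemma IsPoisson.lintegral_tsum_nearest_eq (hc : 0 < c) (h : IsPoisson prob V (rayMeasure c))
    {s t α : ℝ} (hs : 0 ≤ s) (ht : 0 ≤ t) (hα : 2 < α) :
    ∫⁻ ω, ∑' n, expNeg (ENNReal.ofReal (s * V n ω ^ (α / 2)) +
        ∑' m, nearestCost t (α / 2) (V n ω) (V m ω)) ∂prob =
      ENNReal.ofReal c * ∫⁻ x in Set.Ioi 0,
        ENNReal.ofReal (Real.exp (-(s * x ^ (α / 2) + c * x * (1 + rho t α)))) := by
  rw [h.lintegral_tsum_nearest hc hs ht (by linarith), lintegral_rayMeasure]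
  congr 1
  refine setLIntegral_congr_fun measurableSet_Ioi fun x (hx : 0 < x) => ?_
  have := rho_nonneg ht α
  rw [lintegral_one_sub_expNeg_nearestCost hc.le ht hα hx,
    ← ENNReal.ofReal_add (by positivity) (by positivity), expNeg_ofReal (by positivity)]

lemma expNeg_tsum_nearestCost_zero (v : ℕ → ℝ) (β : ℝ) (n : ℕ) :
    expNeg (∑' m, nearestCost 0 β (v n) (v m)) =
      {n | ∀ m, v n ≤ v m}.indicator (fun _ => 1) n := by
  by_cases hn : ∀ m, v n ≤ v m
  · rw [Set.indicator_of_mem (by exact hn)]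
    have : ∀ m, nearestCost 0 β (v n) (v m) = 0 := fun m => by
      simp [nearestCost, (hn m).not_gt]
    simp [this]
  · rw [Set.indicator_of_notMem (by exact hn)]
    push Not at hn
    obtain ⟨m, hm⟩ := hn
    rw [ENNReal.tsum_eq_top_of_eq_top ⟨m, by simp [nearestCost, hm]⟩, expNeg_top]

/-- Bounded intervals hold finitely many points, and the void probability `e^{-cR}` of `(0, R)`
tends to 0, so a minimum is taken over a finite nonempty set. -/
lemma IsPoisson.ae_exists_nearest (hc : 0 < c) (h : IsPoisson prob V (rayMeasure c)) :
    ∀ᵐ ω ∂prob, ∃ n, ∀ m, V n ω ≤ V m ω := by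
  have hν : ∀ R : ℕ, rayMeasure c (Set.Iio (R : ℝ)) = ENNReal.ofReal (c * R) := fun R => by
    rw [rayMeasure_apply c measurableSet_Iio, Set.Iio_inter_Ioi, Real.volume_Ioo, sub_zero,
      ENNReal.ofReal_mul hc.le]
  have hfin : ∀ᵐ ω ∂prob, ∀ R : ℕ, listCount V (Set.Iio (R : ℝ)) ω ≠ ⊤ :=
    ae_all_iff.2 fun R => h.ae_listCount_ne_top measurableSet_Iio (by rw [hν]; simp)
  have hne : ∀ᵐ ω ∂prob, ∃ R : ℕ, listCount V (Set.Iio (R : ℝ)) ω ≠ 0 := by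
    have hle : ∀ R : ℕ, prob {ω | ¬ ∃ R : ℕ, listCount V (Set.Iio (R : ℝ)) ω ≠ 0} ≤
        ENNReal.ofReal (Real.exp (-(c * R))) := by
      intro R
      have h0 := h.count_law (Set.Iio (R : ℝ)) measurableSet_Iio (by rw [hν]; simp) 0
      rw [hν, ENNReal.toReal_ofReal (by positivity)] at h0
      simp only [pow_zero, mul_one, Nat.factorial_zero, Nat.cast_one, div_one] at h0
      rw [← h0]
      refine measure_mono fun ω hω => ?_
      have hω' : ¬ ∃ R : ℕ, listCount V (Set.Iio (R : ℝ)) ω ≠ 0 := hω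
      push Not at hω'
      exact hω' R
    have hlim : Tendsto (fun R : ℕ => ENNReal.ofReal (Real.exp (-(c * R)))) atTop (𝓝 0) := by
      rw [← ENNReal.ofReal_zero]
      refine ENNReal.tendsto_ofReal (Real.tendsto_exp_neg_atTop_nhds_zero.comp ?_)
      exact tendsto_natCast_atTop_atTop.const_mul_atTop hc
    exact le_antisymm (ge_of_tendsto' hlim hle) zero_le
  filter_upwards [hfin, hne] with ω hω1 ⟨R, hR⟩
  have hf : {n : ℕ | V n ω ∈ Set.Iio (R : ℝ)}.Finite := Set.encard_ne_top_iff.1 (hω1 R)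
  have hn : {n : ℕ | V n ω ∈ Set.Iio (R : ℝ)}.Nonempty := Set.encard_ne_zero.1 hR
  obtain ⟨n, hn, hmin⟩ := Set.exists_min_image _ (fun n => V n ω) hf hn
  refine ⟨n, fun m => ?_⟩
  by_cases hm : V m ω < R
  · exact hmin m hm
  · exact (le_of_lt hn).trans (not_lt.1 hm)

/-- Almost surely there is exactly one point closest to the origin. -/
lemma IsPoisson.ae_existsUnique_nearest (hc : 0 < c) (h : IsPoisson prob V (rayMeasure c)) :
    ∀ᵐ ω ∂prob, ∃! n, ∀ m, V n ω ≤ V m ω := by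
  -- For `s = t = 0` the sum counts the nearest points, with mean `∫ c e^{-cx} dx = 1`. The exponent
  -- 3 is an arbitrary choice above 2.
  have hJ := h.lintegral_tsum_nearest_eq hc le_rfl le_rfl (show (2 : ℝ) < 3 by norm_num)
  have hrho : rho 0 3 = 0 := by simp [rho]
  have hcount : ∀ ω, ∑' n, expNeg (ENNReal.ofReal (0 * V n ω ^ ((3 : ℝ) / 2)) +
      ∑' m, nearestCost 0 (3 / 2) (V n ω) (V m ω)) =
      ({n : ℕ | ∀ m, V n ω ≤ V m ω}.encard : ℝ≥0∞) := by
    intro ω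
    simp only [zero_mul, ENNReal.ofReal_zero, zero_add]
    rw [tsum_congr fun n => expNeg_tsum_nearestCost_zero (fun m => V m ω) (3 / 2) n,
      ← tsum_subtype, ENNReal.tsum_set_one]
  have hint : ENNReal.ofReal c * ∫⁻ x in Set.Ioi 0,
      ENNReal.ofReal (Real.exp (-(0 * x ^ ((3 : ℝ) / 2) + c * x * (1 + rho 0 3)))) = 1 := by
    have hexp : ∀ x : ℝ, Real.exp (-(0 * x ^ ((3 : ℝ) / 2) + c * x * (1 + rho 0 3))) =
        Real.exp (-c * x) := fun x => by rw [hrho]; ring_nf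
    simp_rw [hexp]
    rw [← ofReal_integral_eq_lintegral_ofReal (exp_neg_integrableOn_Ioi 0 hc)
      (ae_of_all _ fun x => (Real.exp_pos _).le), integral_exp_mul_Ioi (by linarith),
      ← ENNReal.ofReal_mul hc.le]
    simp [hc.ne']
  have hm : Measurable fun ω => ({n : ℕ | ∀ m, V n ω ≤ V m ω}.encard : ℝ≥0∞) := by
    have heq : (fun ω => ({n : ℕ | ∀ m, V n ω ≤ V m ω}.encard : ℝ≥0∞)) =
        fun ω => ∑' n, {n : ℕ | ∀ m, V n ω ≤ V m ω}.indicator (fun _ => 1) n := by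
      funext ω
      rw [← tsum_subtype, ENNReal.tsum_set_one]
    rw [heq]
    refine Measurable.tsum fun n => ?_
    exact measurable_const.indicator (s := {ω | ∀ m, V n ω ≤ V m ω})
      (measurableSet_setOfPred.2 (Measurable.forall fun m => measurableSet_setOfPred.1
        (measurableSet_le (h.measurable n) (h.measurable m))))
  simp_rw [hcount] at hJ
  rw [hint] at hJ
  have hge : ∀ᵐ ω ∂prob, (1 : ℝ≥0∞) ≤ ({n : ℕ | ∀ m, V n ω ≤ V m ω}.encard : ℝ≥0∞) := by
    filter_upwards [h.ae_exists_nearest hc] with ω hω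
    rw [← ENat.toENNReal_one, ENat.toENNReal_le, Set.one_le_encard_iff_nonempty]
    exact hω
  -- A count that is at least 1 and has mean 1 equals 1 almost surely.
  have heq := ae_eq_of_ae_le_of_lintegral_le hge (by simp) hm.aemeasurable (by simp [hJ])
  filter_upwards [heq] with ω hω
  rw [← ENat.toENNReal_one, ENat.toENNReal_inj] at hω
  obtain ⟨n, hn⟩ := Set.encard_eq_one.1 hω.symm
  refine ⟨n, ?_, fun m hm => ?_⟩
  · exact (hn ▸ Set.mem_singleton n : n ∈ {n : ℕ | ∀ m, V n ω ≤ V m ω})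
  · exact (hn ▸ hm : m ∈ ({n} : Set ℕ))

end

/-! ### From the plane to the half-line; exponential fading. -/

section

lemma dist_sq_measurable (u : Plane) : Measurable fun x : Plane => dist x u ^ 2 := by fun_prop

/-- A disc of squared radius `r` has area `πr`, and the half-lines `Iio r` form a generating
π-system. -/
lemma map_dist_sq_volume (u : Plane) :
    (volume : Measure Plane).map (fun x => dist x u ^ 2) = rayMeasure Real.pi := by
  have hval : ∀ r : ℝ, (volume : Measure Plane).map (fun x => dist x u ^ 2) (Set.Iio r) =
      ENNReal.ofReal (Real.pi * r) := by
    intro r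
    rw [Measure.map_apply (dist_sq_measurable u) measurableSet_Iio]
    rcases le_or_gt r 0 with hr | hr
    · rw [ENNReal.ofReal_of_nonpos (mul_nonpos_of_nonneg_of_nonpos Real.pi_pos.le hr)]
      rw [Set.eq_empty_of_forall_notMem (s := (fun x => dist x u ^ 2) ⁻¹' Set.Iio r)
        fun x hx => (lt_of_lt_of_le hx hr).not_ge (sq_nonneg _), measure_empty]
    · have : (fun x => dist x u ^ 2) ⁻¹' Set.Iio r = Metric.ball u (√r) := by
        ext x
        simp only [Set.mem_preimage, Set.mem_Iio, Metric.mem_ball]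
        exact (Real.lt_sqrt dist_nonneg).symm
      rw [this, EuclideanSpace.volume_ball_fin_two, ← ENNReal.ofReal_pow (Real.sqrt_nonneg r),
        Real.sq_sqrt hr.le, mul_comm Real.pi, ENNReal.ofReal_mul hr.le]
  have hray : ∀ r : ℝ, rayMeasure Real.pi (Set.Iio r) = ENNReal.ofReal (Real.pi * r) := by
    intro r
    rw [rayMeasure_apply _ measurableSet_Iio, Set.Iio_inter_Ioi, Real.volume_Ioo, sub_zero,
      ENNReal.ofReal_mul Real.pi_pos.le]
  refine Measure.ext_of_generateFrom_of_iUnion (Set.range Set.Iio) (fun n : ℕ => Set.Iio (n : ℝ))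
    (BorelSpace.measurable_eq.trans (borel_eq_generateFrom_Iio ℝ)) isPiSystem_Iio ?_
    (fun n => ⟨_, rfl⟩) (fun n => by rw [hval]; simp) ?_
  · refine Set.eq_univ_of_forall fun x => ?_
    obtain ⟨n, hn⟩ := exists_nat_gt x
    exact Set.mem_iUnion.2 ⟨n, hn⟩
  · rintro _ ⟨r, rfl⟩
    rw [hval, hray]

lemma rayMeasure_eq_mul_volume {lam : ℝ} (hlam : 0 ≤ lam) (u : Plane) {B : Set ℝ}
    (hB : MeasurableSet B) :
    rayMeasure (Real.pi * lam) B =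
      ENNReal.ofReal lam * volume ((fun x : Plane => dist x u ^ 2) ⁻¹' B) := by
  rw [← Measure.map_apply (dist_sq_measurable u) hB, map_dist_sq_volume, rayMeasure_apply _ hB,
    rayMeasure_apply _ hB, mul_comm Real.pi, ENNReal.ofReal_mul hlam, mul_assoc]

section
variable {Ω : Type*} [MeasurableSpace Ω] {prob : Measure Ω}

/-- The squared distances of a planar homogeneous Poisson process to a fixed point form a Poisson
process on the half-line. -/
lemma IsHomogeneousPPP.isPoisson_dist_sq {X : ℕ → Ω → Plane} {lam : ℝ} (hlam : 0 < lam)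
    (h : IsHomogeneousPPP prob X lam) (u : Plane) :
    IsPoisson prob (fun n ω => dist (X n ω) u ^ 2) (rayMeasure (Real.pi * lam)) := by
  have hpre : ∀ {B : Set ℝ}, MeasurableSet B →
      MeasurableSet ((fun x : Plane => dist x u ^ 2) ⁻¹' B) := fun hB => dist_sq_measurable u hB
  have hfin : ∀ {B : Set ℝ}, MeasurableSet B → rayMeasure (Real.pi * lam) B ≠ ⊤ →
      volume ((fun x : Plane => dist x u ^ 2) ⁻¹' B) ≠ ⊤ := by
    intro B hB hB' htop
    rw [rayMeasure_eq_mul_volume hlam.le u hB, htop, ENNReal.mul_top (by simpa using hlam)] at hB'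
    exact hB' rfl
  refine ⟨fun n => (dist_sq_measurable u).comp (h.measurable n), fun B hB hB' k => ?_,
    fun m B hB hB' hd => ?_⟩
  · have := h.count_law _ (hpre hB) (hfin hB hB') k
    rw [rayMeasure_eq_mul_volume hlam.le u hB, ENNReal.toReal_mul, ENNReal.toReal_ofReal hlam.le]
    exact this
  · exact h.count_indep m (fun i => (fun x : Plane => dist x u ^ 2) ⁻¹' B i)
      (fun i => hpre (hB i)) (fun i => hfin (hB i) (hB' i)) (fun i j hij => (hd hij).preimage _)

end

lemma expMeasure_lt_ofReal {mu : ℝ} (hmu : 0 < mu) (y : ℝ≥0∞) :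
    expMeasure mu {x | y < ENNReal.ofReal x} = expNeg (ENNReal.ofReal mu * y) := by
  have := isProbabilityMeasure_expMeasure hmu
  rcases eq_or_ne y ⊤ with rfl | hy
  · simp [ENNReal.mul_top (show ENNReal.ofReal mu ≠ 0 by simpa using hmu)]
  obtain ⟨r, hr, rfl⟩ : ∃ r : ℝ, 0 ≤ r ∧ y = ENNReal.ofReal r :=
    ⟨y.toReal, ENNReal.toReal_nonneg, (ENNReal.ofReal_toReal hy).symm⟩
  have h1 : {x | ENNReal.ofReal r < ENNReal.ofReal x} = (Set.Iic r)ᶜ := by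
    ext x
    simp only [Set.mem_ofPred_eq, Set.mem_compl_iff, Set.mem_Iic, not_le,
      ENNReal.ofReal_lt_ofReal_iff']
    exact ⟨fun h => h.1, fun h => ⟨h, hr.trans_lt h⟩⟩
  rw [h1, prob_compl_eq_one_sub measurableSet_Iic, ← ofReal_cdf, cdf_expMeasure_eq hmu, if_pos hr,
    ← ENNReal.ofReal_mul hmu.le, expNeg_ofReal (by positivity), ← ENNReal.ofReal_one,
    ← ENNReal.ofReal_sub _ (sub_nonneg.2 (Real.exp_le_one_iff.2 (by
      have := mul_nonneg hmu.le hr; linarith))), sub_sub_cancel]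

/-- The value is `1 / (1 + b)`, kept as the exponential of a logarithm so that products over
stations become sums of costs. -/
lemma lintegral_expNeg_expMeasure {mu b : ℝ} (hmu : 0 < mu) (hb : 0 ≤ b) :
    ∫⁻ x, expNeg (ENNReal.ofReal mu * (ENNReal.ofReal b * ENNReal.ofReal x)) ∂(expMeasure mu) =
      expNeg (ENNReal.ofReal (Real.log (1 + b))) := by
  have hpdf : Measurable (exponentialPDF mu) := (measurable_exponentialPDFReal mu).ennreal_ofReal
  have h1 : expMeasure mu = volume.withDensity (exponentialPDF mu) := rfl
  have h2 : ∀ x : ℝ, (exponentialPDF mu *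
      fun x => expNeg (ENNReal.ofReal mu * (ENNReal.ofReal b * ENNReal.ofReal x))) x =
      (Set.Ici (0 : ℝ)).indicator
        (fun x => ENNReal.ofReal (mu * Real.exp (-(mu * (1 + b)) * x))) x := by
    intro x
    rw [Pi.mul_apply, exponentialPDF_eq]
    by_cases hx : 0 ≤ x
    · rw [if_pos hx, Set.indicator_of_mem (Set.mem_Ici.2 hx), ← ENNReal.ofReal_mul hb,
        ← ENNReal.ofReal_mul hmu.le, expNeg_ofReal (by positivity),
        ← ENNReal.ofReal_mul (by positivity), mul_assoc, ← Real.exp_add]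
      ring_nf
    · rw [if_neg hx, Set.indicator_of_notMem (by simpa using hx), ENNReal.ofReal_zero, zero_mul]
  have hpos : 0 < mu * (1 + b) := by positivity
  rw [h1, lintegral_withDensity_eq_lintegral_mul _ hpdf (by fun_prop), lintegral_congr h2,
    lintegral_indicator measurableSet_Ici, setLIntegral_congr Ioi_ae_eq_Ici.symm,
    ← ofReal_integral_eq_lintegral_ofReal ((exp_neg_integrableOn_Ioi 0 hpos).const_mul mu)
      (ae_of_all _ fun x => by positivity), integral_const_mul,
    integral_exp_mul_Ioi (by linarith), expNeg_ofReal_log (by linarith)]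
  congr 1
  simp
  field_simp

/-- Measurability of `g n` is not required, so the lemma also applies to the σ-algebra generated by
the other fadings, giving independence from `g n`. -/
lemma measurable_weighted_sum {Ω : Type*} [MeasurableSpace Ω] {g : ℕ → Ω → ℝ} {b : ℕ → ℝ} {n : ℕ}
    (hbn : b n = 0) (a : ℝ≥0∞) (hg : ∀ m ≠ n, Measurable (g m)) :
    Measurable fun ω => a + ∑' m, ENNReal.ofReal (b m) * ENNReal.ofReal (g m ω) := by
  refine measurable_const.add (Measurable.tsum fun m => ?_)
  by_cases hm : m = n
  · simp [hm, hbn]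
  · have := hg m hm
    fun_prop

section
variable {Ω : Type*} [MeasurableSpace Ω] {prob : Measure Ω} [IsProbabilityMeasure prob]
  {g : ℕ → Ω → ℝ} {mu : ℝ}

lemma lintegral_expNeg_tsum_fading (hmu : 0 < mu) (hg : ∀ n, Measurable (g n))
    (hlaw : ∀ n, prob.map (g n) = expMeasure mu) (hind : iIndepFun g prob)
    {b : ℕ → ℝ} (hb : ∀ n, 0 ≤ b n) :
    ∫⁻ ω, expNeg (ENNReal.ofReal mu * ∑' m, ENNReal.ofReal (b m) * ENNReal.ofReal (g m ω)) ∂prob =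
      expNeg (∑' m, ENNReal.ofReal (Real.log (1 + b m))) := by
  simp_rw [← ENNReal.tsum_mul_left]
  have hφ : ∀ m, Measurable fun x : ℝ =>
      expNeg (ENNReal.ofReal mu * (ENNReal.ofReal (b m) * ENNReal.ofReal x)) := fun m => by fun_prop
  have hfinite : ∀ N : ℕ, ∫⁻ ω, expNeg (∑ m ∈ Finset.range N,
      ENNReal.ofReal mu * (ENNReal.ofReal (b m) * ENNReal.ofReal (g m ω))) ∂prob =
      expNeg (∑ m ∈ Finset.range N, ENNReal.ofReal (Real.log (1 + b m))) := by
    intro N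
    simp_rw [expNeg_sum]
    have h1 := lintegral_prod_eq_prod_lintegral_of_indepFun (Finset.range N) _
      (hind.comp _ hφ) (fun m => (hφ m).comp (hg m))
    simp only [Function.comp_apply] at h1
    rw [h1]
    refine Finset.prod_congr rfl fun m _ => ?_
    rw [← lintegral_expNeg_expMeasure hmu (hb m), ← hlaw m, lintegral_map (hφ m) (hg m)]
  have hlim : Tendsto (fun N => ∫⁻ ω, expNeg (∑ m ∈ Finset.range N,
      ENNReal.ofReal mu * (ENNReal.ofReal (b m) * ENNReal.ofReal (g m ω))) ∂prob) atTop
      (𝓝 (∫⁻ ω, expNeg (∑' m,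
        ENNReal.ofReal mu * (ENNReal.ofReal (b m) * ENNReal.ofReal (g m ω))) ∂prob)) := by
    refine lintegral_tendsto_of_tendsto_of_antitone (fun N => ?_)
      (ae_of_all _ fun ω i j hij => expNeg_antitone
        (Finset.sum_le_sum_of_subset (Finset.range_mono hij))) ?_
      (ae_of_all _ fun ω => expNeg_tendsto (ENNReal.tendsto_nat_tsum _))
    · exact Measurable.aemeasurable (by fun_prop)
    · simp
  simp_rw [hfinite] at hlim
  exact tendsto_nhds_unique hlim (expNeg_tendsto (ENNReal.tendsto_nat_tsum _))

/-- Given the independent sum `Y`, the exponential tail gives `e^{-μY}`; the Laplace transform of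
the fadings evaluates its mean. -/
lemma prob_interference_lt_fading (hmu : 0 < mu) (hg : ∀ n, Measurable (g n))
    (hlaw : ∀ n, prob.map (g n) = expMeasure mu) (hind : iIndepFun g prob)
    {b : ℕ → ℝ} (hb : ∀ n, 0 ≤ b n) {n : ℕ} (hbn : b n = 0) (a : ℝ≥0∞) :
    prob {ω | a + ∑' m, ENNReal.ofReal (b m) * ENNReal.ofReal (g m ω) < ENNReal.ofReal (g n ω)} =
      expNeg (ENNReal.ofReal mu * a + ∑' m, ENNReal.ofReal (Real.log (1 + b m))) := by
  set Y : Ω → ℝ≥0∞ := fun ω => a + ∑' m, ENNReal.ofReal (b m) * ENNReal.ofReal (g m ω) with hY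
  have hYm : Measurable Y := measurable_weighted_sum hbn a fun m _ => hg m
  have hindep : IndepFun Y (g n) prob := by
    have h1 := indep_iSup_of_disjoint (fun i => (hg i).comap_le) hind.iIndep
      (S := {n}ᶜ) (T := {n}) disjoint_compl_left
    rw [IndepFun_iff_Indep]
    refine indep_of_indep_of_le_left (indep_of_indep_of_le_right h1 ?_) ?_
    · exact le_iSup₂_of_le (f := fun i (_ : i ∈ ({n} : Set ℕ)) =>
        MeasurableSpace.comap (g i) inferInstance) n rfl le_rfl
    · rw [← measurable_iff_comap_le]
      refine @measurable_weighted_sum Ω (_) g b n hbn a fun m hm => ?_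
      rw [measurable_iff_comap_le]
      exact le_iSup₂_of_le (f := fun i (_ : i ∈ ({n}ᶜ : Set ℕ)) =>
        MeasurableSpace.comap (g i) inferInstance) m hm le_rfl
  have hmap := (indepFun_iff_map_prod_eq_prod_map_map hYm.aemeasurable (hg n).aemeasurable).1 hindep
  have := isProbabilityMeasure_expMeasure hmu
  have hset : MeasurableSet {p : ℝ≥0∞ × ℝ | p.1 < ENNReal.ofReal p.2} :=
    measurableSet_lt measurable_fst (by fun_prop)
  have h2 : prob {ω | Y ω < ENNReal.ofReal (g n ω)} =
      prob.map (fun ω => (Y ω, g n ω)) {p : ℝ≥0∞ × ℝ | p.1 < ENNReal.ofReal p.2} := by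
    rw [Measure.map_apply (hYm.prodMk (hg n)) hset]; rfl
  rw [h2, hmap, hlaw n, Measure.prod_apply hset,
    lintegral_map (measurable_measure_prodMk_left hset) hYm, expNeg_add,
    ← lintegral_expNeg_tsum_fading hmu hg hlaw hind hb, ← lintegral_const_mul]
  · refine lintegral_congr fun ω => ?_
    rw [← expNeg_add, ← mul_add]
    exact expMeasure_lt_ofReal hmu (Y ω)
  · refine expNeg_measurable.comp (Measurable.const_mul (Measurable.tsum fun m => ?_) _)
    have := hg m
    fun_prop

end

end

/-! ### The SINR: measurability, conditioning on locations, coverage probability. -/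

section

section
variable {Ω : Type*} [MeasurableSpace Ω] {X : ℕ → Ω → Plane} {g : ℕ → Ω → ℝ}

lemma measurable_serving (hX : ∀ n, Measurable (X n)) (u : Plane) :
    Measurable (serving X u) := by
  have hS : ∀ n, MeasurableSet {ω | ∀ m, dist (X n ω) u ≤ dist (X m ω) u} := fun n =>
    measurableSet_setOfPred.2 (Measurable.forall fun m => measurableSet_setOfPred.1
      (measurableSet_le ((hX n).dist measurable_const) ((hX m).dist measurable_const)))
  refine measurable_to_countable' fun n => ?_
  have h1 : serving X u ⁻¹' {n} =
      ({ω | ∀ m, dist (X n ω) u ≤ dist (X m ω) u} ∩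
        ⋂ i, ⋂ (_ : i < n), {ω | ∀ m, dist (X i ω) u ≤ dist (X m ω) u}ᶜ) ∪
      -- As `sInf ∅ = 0`, the fibre over 0 also contains the configurations without a nearest point.
      (if n = 0 then ⋂ i, {ω | ∀ m, dist (X i ω) u ≤ dist (X m ω) u}ᶜ else ∅) := by
    ext ω
    set A : Set ℕ := {n : ℕ | ∀ m, dist (X n ω) u ≤ dist (X m ω) u} with hA
    have e1 : ω ∈ serving X u ⁻¹' {n} ↔ sInf A = n := Iff.rfl
    have e2 : ∀ i, ω ∈ {ω | ∀ m, dist (X i ω) u ≤ dist (X m ω) u} ↔ i ∈ A := fun i => Iff.rfl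
    have e3 : ω ∈ (if n = 0 then ⋂ i, {ω | ∀ m, dist (X i ω) u ≤ dist (X m ω) u}ᶜ else ∅) ↔
        n = 0 ∧ ∀ i, i ∉ A := by
      split_ifs with hn
      · simp only [Set.mem_iInter, Set.mem_compl_iff, e2, hn, true_and]
      · simp [hn]
    rw [e1, Set.mem_union, e3, Set.mem_inter_iff, e2]
    simp only [Set.mem_iInter, Set.mem_compl_iff, e2]
    constructor
    · rintro rfl
      rcases A.eq_empty_or_nonempty with h | h
      · right; simp [h]
      · exact Or.inl ⟨Nat.sInf_mem h, fun i hi => Nat.notMem_of_lt_sInf hi⟩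
    · rintro (⟨h1, h2⟩ | ⟨h1, h2⟩)
      · refine le_antisymm (Nat.sInf_le h1) (not_lt.1 fun h => h2 _ h (Nat.sInf_mem ⟨n, h1⟩))
      · rw [Set.eq_empty_of_forall_notMem h2, Nat.sInf_empty, h1]
  rw [h1]
  refine MeasurableSet.union ((hS n).inter (MeasurableSet.iInter fun i =>
    MeasurableSet.iInter fun _ => (hS i).compl)) ?_
  split_ifs
  · exact MeasurableSet.iInter fun i => (hS i).compl
  · exact MeasurableSet.empty

omit [MeasurableSpace Ω] in
lemma interference_eq_tsum (α : ℝ) (u : Plane) (ω : Ω) :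
    interference X g α u ω = ∑' m, if m = serving X u ω then 0 else
      ENNReal.ofReal (g m ω) * edist (X m ω) u ^ (-α) := by
  have h1 := tsum_subtype {n : ℕ | n ≠ serving X u ω}
    fun m => ENNReal.ofReal (g m ω) * edist (X m ω) u ^ (-α)
  refine Eq.trans h1 (tsum_congr fun m => ?_)
  by_cases hm : m = serving X u ω <;> simp [Set.indicator, hm]

lemma measurable_sinr (hX : ∀ n, Measurable (X n)) (hg : ∀ n, Measurable (g n))
    (P σ α : ℝ) (u : Plane) : Measurable (sinr X g P σ α u) := by
  have hs := measurable_serving hX u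
  have hterm : ∀ m, Measurable fun ω => ENNReal.ofReal (g m ω) * edist (X m ω) u ^ (-α) := by
    intro m
    exact ((hg m).ennreal_ofReal).mul (((hX m).edist measurable_const).pow_const _)
  have hI : Measurable (interference X g α u) := by
    have : interference X g α u = fun ω => ∑' m, if m = serving X u ω then 0 else
      ENNReal.ofReal (g m ω) * edist (X m ω) u ^ (-α) := funext (interference_eq_tsum α u)
    rw [this]
    exact Measurable.tsum fun m => Measurable.ite
      (measurableSet_eq_fun measurable_const hs) measurable_const (hterm m)
  have hgs : Measurable fun ω => g (serving X u ω) ω :=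
    (measurable_from_prod_countable_right (f := fun p : ℕ × Ω => g p.1 p.2) hg).comp
      (hs.prodMk measurable_id)
  have hXs : Measurable fun ω => X (serving X u ω) ω :=
    (measurable_from_prod_countable_right (f := fun p : ℕ × Ω => X p.1 p.2) hX).comp
      (hs.prodMk measurable_id)
  exact ((hgs.ennreal_ofReal.const_mul _).mul
    ((hXs.edist measurable_const).pow_const _)).div ((hI.const_mul _).const_add _)

lemma measurableSet_sinrAbove (hX : ∀ n, Measurable (X n)) (hg : ∀ n, Measurable (g n))
    (P σ α : ℝ) (u : Plane) (t : ℝ) : MeasurableSet (sinrAbove X g P σ α u t) :=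
  measurableSet_lt measurable_const (measurable_sinr hX hg P σ α u)

end

lemma edist_rpow_neg {x u : Plane} (hx : 0 < dist x u) (α : ℝ) :
    edist x u ^ (-α) = ENNReal.ofReal (dist x u ^ (-α)) := by
  rw [edist_dist, ENNReal.ofReal_rpow_of_pos hx]

lemma sq_rpow_half {d : ℝ} (hd : 0 ≤ d) (α : ℝ) : (d ^ 2) ^ (α / 2) = d ^ α := by
  rw [← Real.rpow_natCast, ← Real.rpow_mul hd]
  congr 1
  push_cast
  ring

lemma serving_const {Ω : Type*} {x : ℕ → Plane} {u : Plane} {n : ℕ}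
    (hmin : ∀ m ≠ n, dist (x n) u < dist (x m) u) (ω : Ω) :
    serving (fun i _ => x i) u ω = n := by
  have : {k : ℕ | ∀ m, dist (x k) u ≤ dist (x m) u} = {n} := by
    ext k
    simp only [Set.mem_ofPred_eq, Set.mem_singleton_iff]
    constructor
    · intro hk
      by_contra hne
      exact (hmin k hne).not_ge (hk n)
    · rintro rfl m
      by_cases hm : m = k
      · rw [hm]
      · exact (hmin m hm).le
  change sInf {k : ℕ | ∀ m, dist (x k) u ≤ dist (x m) u} = n
  rw [this, csInf_singleton]

/-- For deterministic base stations the event `SINR > t` compares the fading coefficient of the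
serving base station with a weighted sum of the others. -/
lemma lt_sinr_const_iff {Ω : Type*} {x : ℕ → Plane} {u : Plane} {g : ℕ → Ω → ℝ} {P σ α t : ℝ}
    (hP : 0 < P) (ht : 0 < t) {n : ℕ} (hpos : ∀ m, 0 < dist (x m) u)
    (hmin : ∀ m ≠ n, dist (x n) u < dist (x m) u) (ω : Ω) :
    ENNReal.ofReal t < sinr (fun i _ => x i) g P σ α u ω ↔
      ENNReal.ofReal (t * (σ ^ 2 / P) * dist (x n) u ^ α) + ∑' m, ENNReal.ofReal
        (if m = n then 0 else t * (dist (x n) u / dist (x m) u) ^ α) * ENNReal.ofReal (g m ω) <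
      ENNReal.ofReal (g n ω) := by
  set d := dist (x n) u with hd
  have hd0 : 0 < d := hpos n
  have hκ : 0 < P * d ^ (-α) := by positivity
  have ht' : ENNReal.ofReal t ≠ 0 := by simpa using ht
  -- The denominator may be 0 or `∞`; cross-multiplication is still valid because the threshold is
  -- finite and nonzero.
  rw [sinr, interference_eq_tsum, serving_const hmin, edist_rpow_neg (hpos n), ← hd,
    ENNReal.lt_div_iff_mul_lt (Or.inr ENNReal.ofReal_ne_top) (Or.inr ht'),
    show ENNReal.ofReal P * ENNReal.ofReal (g n ω) * ENNReal.ofReal (d ^ (-α)) =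
      ENNReal.ofReal (g n ω) * ENNReal.ofReal (P * d ^ (-α)) by
        rw [ENNReal.ofReal_mul hP.le]; ring,
    ← ENNReal.div_lt_iff (Or.inl (by simpa using hκ)) (Or.inl ENNReal.ofReal_ne_top)]
  have hdα : 0 < d ^ α := by positivity
  have hcoef : (P * d ^ (-α))⁻¹ = d ^ α / P := by
    rw [Real.rpow_neg hd0.le]; field_simp
  have hsum : ENNReal.ofReal (t * d ^ α) * ∑' m, (if m = n then 0 else
      ENNReal.ofReal (g m ω) * edist (x m) u ^ (-α)) = ∑' m, ENNReal.ofReal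
        (if m = n then 0 else t * (d / dist (x m) u) ^ α) * ENNReal.ofReal (g m ω) := by
    rw [← ENNReal.tsum_mul_left]
    refine tsum_congr fun m => ?_
    split_ifs with hm
    · simp
    · rw [edist_rpow_neg (hpos m), Real.div_rpow hd0.le (hpos m).le, Real.rpow_neg (hpos m).le,
        mul_comm (ENNReal.ofReal (g m ω)), ← mul_assoc, ← ENNReal.ofReal_mul (by positivity),
        div_eq_mul_inv, mul_assoc]
  have hcollect : ∀ I : ℝ≥0∞, ENNReal.ofReal t * (ENNReal.ofReal (σ ^ 2) + ENNReal.ofReal P * I) *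
      ENNReal.ofReal (d ^ α / P) =
      ENNReal.ofReal (t * (σ ^ 2 / P) * d ^ α) + ENNReal.ofReal (t * d ^ α) * I := by
    intro I
    rw [show t * (σ ^ 2 / P) * d ^ α = t * σ ^ 2 * (d ^ α / P) by ring,
      show t * d ^ α = t * P * (d ^ α / P) by field_simp, ENNReal.ofReal_mul (by positivity),
      ENNReal.ofReal_mul ht.le, ENNReal.ofReal_mul (p := t * P) (by positivity),
      ENNReal.ofReal_mul ht.le]
    ring
  rw [← hsum, div_eq_mul_inv, ← ENNReal.ofReal_inv_of_pos hκ, hcoef, hcollect]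

variable {Ω : Type*} [MeasurableSpace Ω] {prob : Measure Ω} [IsProbabilityMeasure prob]
  {X : ℕ → Ω → Plane} {g : ℕ → Ω → ℝ} {lam mu P σ α t : ℝ}

/-- Every index other than the nearest incurs an infinite cost, so the sum reduces to one term;
writing it as a sum over all points is what the Mecke-type formula needs. -/
lemma prob_sinr_const (hmu : 0 < mu) (hP : 0 < P) (ht : 0 < t)
    (hg : ∀ n, Measurable (g n)) (hlaw : ∀ n, prob.map (g n) = expMeasure mu)
    (hind : iIndepFun g prob) {x : ℕ → Plane} {u : Plane} (hpos : ∀ m, 0 < dist (x m) u ^ 2)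
    (huniq : ∃! n, ∀ m, dist (x n) u ^ 2 ≤ dist (x m) u ^ 2) :
    prob {ω | ENNReal.ofReal t < sinr (fun i _ => x i) g P σ α u ω} =
      ∑' n, expNeg (ENNReal.ofReal (mu * t * (σ ^ 2 / P) * (dist (x n) u ^ 2) ^ (α / 2)) +
        ∑' m, nearestCost t (α / 2) (dist (x n) u ^ 2) (dist (x m) u ^ 2)) := by
  obtain ⟨n, hn, hn'⟩ := huniq
  have hpos' : ∀ m, 0 < dist (x m) u := fun m => by
    have := (hpos m).ne'
    exact lt_of_le_of_ne dist_nonneg (fun h => this (by rw [← h]; simp))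
  have hminsq : ∀ m ≠ n, dist (x n) u ^ 2 < dist (x m) u ^ 2 := fun m hm =>
    lt_of_le_of_ne (hn m) fun h => hm (hn' m fun k => h ▸ hn k)
  have hmin : ∀ m ≠ n, dist (x n) u < dist (x m) u := fun m hm =>
    lt_of_pow_lt_pow_left₀ 2 dist_nonneg (hminsq m hm)
  simp_rw [lt_sinr_const_iff (σ := σ) (α := α) hP ht hpos' hmin]
  rw [prob_interference_lt_fading hmu hg hlaw hind
    (b := fun m => if m = n then 0 else t * (dist (x n) u / dist (x m) u) ^ α)
    (fun m => by split_ifs <;> positivity) (by simp)]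
  symm
  rw [tsum_eq_single n]
  · congr 1
    congr 1
    · rw [← ENNReal.ofReal_mul hmu.le, sq_rpow_half dist_nonneg]
      congr 1
      ring
    · refine tsum_congr fun m => ?_
      by_cases hm : m = n
      · simp [hm, nearestCost]
      · rw [if_neg hm, nearestCost, if_neg (hminsq m hm).not_gt, if_neg (hminsq m hm).ne', ← div_pow,
          sq_rpow_half (by positivity)]
  · intro k hk
    rw [ENNReal.tsum_eq_top_of_eq_top ⟨n, by simp [nearestCost, hminsq k hk]⟩]
    simp

lemma IsDownlink.lintegral_prob_sinr (h : IsDownlink prob X g lam mu) (u : Plane) (t : ℝ) :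
    prob (sinrAbove X g P σ α u t) =
      ∫⁻ ω, prob {ω' | ENNReal.ofReal t < sinr (fun i _ => X i ω) g P σ α u ω'} ∂prob := by
  -- The event on the canonical space of locations and fadings, where independence gives a product
  -- law and Fubini applies.
  let Q : Set ((ℕ → Plane) × (ℕ → ℝ)) :=
    sinrAbove (fun i p => p.1 i) (fun i p => p.2 i) P σ α u t
  have hQ : MeasurableSet Q := measurableSet_sinrAbove (fun n => by fun_prop)
    (fun n => by fun_prop) P σ α u t
  have hXm : Measurable fun ω n => X n ω := measurable_pi_lambda _ h.ppp.measurable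
  have hgm : Measurable fun ω n => g n ω := measurable_pi_lambda _ h.fading_measurable
  have hmap := (indepFun_iff_map_prod_eq_prod_map_map hXm.aemeasurable hgm.aemeasurable).1
    h.fading_indep_locations.symm
  have h1 : prob (sinrAbove X g P σ α u t) =
      prob.map (fun ω => ((fun n => X n ω), (fun n => g n ω))) Q := by
    rw [Measure.map_apply (hXm.prodMk hgm) hQ]; rfl
  rw [h1, hmap, Measure.prod_apply hQ, lintegral_map (measurable_measure_prodMk_left hQ) hXm]
  refine lintegral_congr fun ω => ?_
  rw [Measure.map_apply hgm (measurable_prodMk_left hQ)]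
  rfl

lemma pc_integrand_integrable (hlam : 0 < lam) (hmu : 0 < mu) (hP : 0 < P) (ht : 0 ≤ t) :
    IntegrableOn (fun v => Real.exp (-Real.pi * lam * v * (1 + 1 / 1 * rho t α) -
      mu * t * (σ ^ 2 / P) * v ^ (α / 2))) (Set.Ioi 0) := by
  have hρ := rho_nonneg ht α
  have h1 : IntegrableOn (fun v => Real.exp (-(Real.pi * lam) * v)) (Set.Ioi 0) :=
    exp_neg_integrableOn_Ioi 0 (by positivity)
  refine Integrable.mono' h1 (Measurable.aestronglyMeasurable (by fun_prop)) ?_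
  filter_upwards [ae_restrict_mem measurableSet_Ioi] with v hv
  have hv0 : 0 < v := hv
  rw [Real.norm_of_nonneg (Real.exp_pos _).le]
  refine Real.exp_le_exp.2 ?_
  have h2 : 0 ≤ mu * t * (σ ^ 2 / P) * v ^ (α / 2) := by positivity
  have h3 : 0 ≤ Real.pi * lam * v * rho t α := by positivity
  linarith

lemma pc_pos (hlam : 0 < lam) (hmu : 0 < mu) (hP : 0 < P) (ht : 0 ≤ t) :
    0 < pc mu σ P t lam α 1 := by
  refine mul_pos (by positivity) ?_
  rw [setIntegral_pos_iff_support_of_nonneg_ae (ae_of_all _ fun v => (Real.exp_pos _).le)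
    (pc_integrand_integrable hlam hmu hP ht)]
  rw [Function.support_eq_univ fun v => (Real.exp_pos _).ne']
  simp

/-- The coverage probability on the shared sub-band. -/
lemma IsDownlink.prob_sinrAbove (h : IsDownlink prob X g lam mu) (hlam : 0 < lam) (hmu : 0 < mu)
    (hP : 0 < P) (hα : 2 < α) (ht : 0 < t) (u : Plane) :
    prob (sinrAbove X g P σ α u t) = ENNReal.ofReal (pc mu σ P t lam α 1) := by
  have hc : 0 < Real.pi * lam := by positivity
  have hV := h.ppp.isPoisson_dist_sq hlam u
  have hae : ∀ᵐ ω ∂prob,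
      prob {ω' | ENNReal.ofReal t < sinr (fun i _ => X i ω) g P σ α u ω'} =
      ∑' n, expNeg (ENNReal.ofReal
        (mu * t * (σ ^ 2 / P) * (dist (X n ω) u ^ 2) ^ (α / 2)) +
        ∑' m, nearestCost t (α / 2) (dist (X n ω) u ^ 2) (dist (X m ω) u ^ 2)) := by
    filter_upwards [hV.ae_pos, hV.ae_existsUnique_nearest hc] with ω hω1 hω2
    exact prob_sinr_const hmu hP ht h.fading_measurable h.fading_law h.fading_iIndep hω1 hω2
  rw [h.lintegral_prob_sinr, lintegral_congr_ae hae,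
    hV.lintegral_tsum_nearest_eq hc (s := mu * t * (σ ^ 2 / P)) (by positivity) ht.le hα, pc,
    ENNReal.ofReal_mul hc.le, ofReal_integral_eq_lintegral_ofReal
      (pc_integrand_integrable hlam hmu hP ht.le) (ae_of_all _ fun v => (Real.exp_pos _).le)]
  congr 1
  refine lintegral_congr fun v => ?_
  congr 2
  ring

end

end StrictFFR

end

theorem theorem2 {Ω : Type*} [MeasurableSpace Ω] (prob : Measure Ω) [IsProbabilityMeasure prob]
    (X : ℕ → Ω → StrictFFR.Plane) (g : ℕ → Ω → ℝ)
    (lam mu P σ α TFR : ℝ) (hlam : 0 < lam) (hmu : 0 < mu) (hP : 0 < P) (hα : 2 < α)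
    (hTFR : 0 < TFR) (hmodel : StrictFFR.IsDownlink prob X g lam mu)
    (u : StrictFFR.Plane) (T : ℝ) :
    0 < prob (StrictFFR.sinrAbove X g P σ α u TFR) ∧
    0 < StrictFFR.pc mu σ P TFR lam α 1 ∧
    StrictFFR.interiorCoverage prob X g P σ α u TFR T =
      StrictFFR.pc mu σ P (max T TFR) lam α 1 / StrictFFR.pc mu σ P TFR lam α 1 := by
  have hpc : 0 < StrictFFR.pc mu σ P TFR lam α 1 := StrictFFR.pc_pos hlam hmu hP hTFR.le
  have hprob := hmodel.prob_sinrAbove (σ := σ) hlam hmu hP hα hTFR u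
  have hmax : 0 < max T TFR := lt_max_of_lt_right hTFR
  refine ⟨by rw [hprob]; simpa using hpc, hpc, ?_⟩
  -- `ENNReal.ofReal` is monotone, hence commutes with `max`; this covers negative `T` too.
  have hinter : StrictFFR.sinrAbove X g P σ α u TFR ∩ StrictFFR.sinrAbove X g P σ α u T =
      StrictFFR.sinrAbove X g P σ α u (max T TFR) := by
    ext ω
    have h1 : ω ∈ StrictFFR.sinrAbove X g P σ α u (max T TFR) ↔
        ENNReal.ofReal (max T TFR) < StrictFFR.sinr X g P σ α u ω := Iff.rfl
    rw [h1, (ENNReal.ofReal_mono).map_max, max_lt_iff]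
    exact and_comm
  rw [StrictFFR.interiorCoverage, cond_apply (StrictFFR.measurableSet_sinrAbove
      hmodel.ppp.measurable hmodel.fading_measurable P σ α u TFR), hinter,
    hmodel.prob_sinrAbove hlam hmu hP hα hmax u, hprob, ENNReal.toReal_mul, ENNReal.toReal_inv,
    ENNReal.toReal_ofReal hpc.le,
    ENNReal.toReal_ofReal (StrictFFR.pc_pos hlam hmu hP hmax.le).le, div_eq_inv_mul]
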